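/- Let $\mathfrak g$ be a finite-dimensional complex simple Lie algebra of rank $n$ with Cartan subalgebra $\mathfrak h$, simple roots $\alpha_i$ and simple coroots $h_i$ ($i\in I=\{1,\dots,n\}$), and fix $x_i^\pm\in\mathfrak g_{\pm\alpha_i}$ with $[x_i^+,x_i^-]=h_i$. Let $L(\mathfrak g)=\mathfrak g\otimes\mathbb C[t,t^{-1}]$ be the loop algebra, $\mathbf U=U(L(\mathfrak g))$ its universal enveloping algebra, and write $x_m=x\otimes t^m$ for $x\in\mathfrak g$, $m\in\mathbb Z$. Let $\mathbf U(0)\subset\mathbf U$ be the (commutative) subalgebra generated by the $h_{i,m}$ with $i\in I$, $m\neq 0$. Define $\Lambda_{i,m}$ ($m\in\mathbb Z$) by $$\Lambda_i^\pm(u)=\sum_{m\ge 0}\Lambda_{i,\pm m}u^m=\exp\Big(-\sum_{k\ge 1}\frac{h_{i,\pm k}}{k}u^k\Big),$$ and put $\tilde X_i^-(u)=\sum_{m\in\mathbb Z}x^-_{i,m}u^{m+1}$ and $X_{i,0}^-(u)=\sum_{m\ge 0}x^-_{i,m}u^{m+1}$; $(\cdot)_m$ denotes the coefficient of $u^m$.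 For a dominant integral weight $\lambda$, let $W(\lambda)=\mathbf U/\tilde I_\lambda$, where $\tilde I_\lambda$ is the left ideal of $\mathbf U$ generated by: $x^+_{i,m}$ ($i\in I$, $m\in\mathbb Z$); $h-\lambda(h)$ ($h\in\mathfrak h$); $\Lambda_{i,m}$ ($|m|>\lambda(h_i)$); $\Lambda_{i,\lambda(h_i)}\Lambda_{i,-m}-\Lambda_{i,\lambda(h_i)-m}$ ($1\le m\le\lambda(h_i)$); $(\tilde X_i^-(u)\Lambda_i^+(u))_m\,\mathbf U(0)$ ($m\in\mathbb Z$), where only the terms involving $\Lambda_{i,k}$ with $k\le\lambda(h_i)$ are kept; and $(X_{i,0}^-(u)^r\Lambda_i^+(u))_m\,\mathbf U(0)$ ($r\ge 1$, $m>\lambda(h_i)$). The left ideal $\tilde I_\lambda$ is stable under right multiplication by $\mathbf U(0)$, so $W(\lambda)$ is a right $\mathbf U(0)$-module. For an $n$-tuple $\boldsymbol\pi=(\pi_1,\dots,\pi_n)$ of polynomials in $\mathbb C[u]$ with constant term $1$, let $\lambda_{\boldsymbol\pi}$ be the weight with $\lambda_{\boldsymbol\pi}(h_i)=\deg\pi_i$,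 let $\pi_i^+=\pi_i$, let $\pi_i^-(u)$ be $u^{\deg\pi_i}\pi_i(u^{-1})$ divided by its constant term, let $I_{\boldsymbol\pi}(0)$ be the ideal of $\mathbf U(0)$ generated by all coefficients of $\Lambda_i^\pm(u)-\pi_i^\pm(u)$ ($i\in I$), let $\mathbb C_{\boldsymbol\pi}=\mathbf U(0)/I_{\boldsymbol\pi}(0)$, and let $$W(\boldsymbol\pi)=W(\lambda_{\boldsymbol\pi})\otimes_{\mathbf U(0)}\mathbb C_{\boldsymbol\pi}=W(\lambda_{\boldsymbol\pi})/W(\lambda_{\boldsymbol\pi})I_{\boldsymbol\pi}(0).$$ **Theorem.** Let $\boldsymbol\pi=(\pi_1,\dots,\pi_n)$ and $\tilde{\boldsymbol\pi}=(\tilde\pi_1,\dots,\tilde\pi_n)$ be $n$-tuples of polynomials in $\mathbb C[u]$ with constant term $1$ such that $\pi_i$ and $\tilde\pi_j$ are coprime for all $1\le i,j\le n$. Then $$W(\boldsymbol\pi\tilde{\boldsymbol\pi})\cong W(\boldsymbol\pi)\otimes_{\mathbb C}W(\tilde{\boldsymbol\pi})$$ as $L(\mathfrak g)$-modules (equivalently,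 as $\mathbf U$-modules), where $\boldsymbol\pi\tilde{\boldsymbol\pi}=(\pi_1\tilde\pi_1,\dots,\pi_n\tilde\pi_n)$. -/

import Mathlib

open scoped TensorProduct Polynomial

noncomputable section

namespace LoopWeyl

/-- The loop algebra `L(𝔤) = 𝔤 ⊗ ℂ[t, t⁻¹]`. -/
abbrev Loop (𝔤 : Type*) [LieRing 𝔤] [LieAlgebra ℂ 𝔤] : Type _ :=
  LieAlgebra.loopAlgebra ℂ ℤ 𝔤

/-- The universal enveloping algebra `U = U(L(𝔤))`. -/
abbrev ULoop (𝔤 : Type*) [LieRing 𝔤] [LieAlgebra ℂ 𝔤] : Type _ :=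
  UniversalEnvelopingAlgebra ℂ (Loop 𝔤)

section Series

variable {𝔤 : Type*} [LieRing 𝔤] [LieAlgebra ℂ 𝔤]

/-- The element `x_m = x ⊗ t^m` of `L(𝔤)`, viewed in `U`. -/
def gen (x : 𝔤) (m : ℤ) : ULoop 𝔤 :=
  UniversalEnvelopingAlgebra.ι ℂ
    ((LaurentPolynomial.T m : LaurentPolynomial ℂ) ⊗ₜ[ℂ] x : Loop 𝔤)

/-- The exponential `∑ j, F ^ j / j!` of a power series `F` with zero constant term
(the powers `F ^ j` with `j > m` do not contribute to the coefficient of `u ^ m`). -/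
def expSeries {A : Type*} [Ring A] [Algebra ℂ A] (F : PowerSeries A) : PowerSeries A :=
  PowerSeries.mk fun m =>
    ∑ j ∈ Finset.range (m + 1), ((j.factorial : ℂ)⁻¹) • PowerSeries.coeff m (F ^ j)

/-- `Λ⁺(u) = exp (- ∑_{k ≥ 1} h_k u^k / k)`. -/
def lambdaPlus (h : 𝔤) : PowerSeries (ULoop 𝔤) :=
  expSeries (-PowerSeries.mk fun k : ℕ => if k = 0 then 0 else ((k : ℂ)⁻¹) • gen h (k : ℤ))

/-- `Λ⁻(u) = exp (- ∑_{k ≥ 1} h_{-k} u^k / k)`. -/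
def lambdaMinus (h : 𝔤) : PowerSeries (ULoop 𝔤) :=
  expSeries (-PowerSeries.mk fun k : ℕ => if k = 0 then 0 else ((k : ℂ)⁻¹) • gen h (-(k : ℤ)))

/-- The elements `Λ_m` for `m : ℤ`: the coefficient of `u^m` in `Λ⁺(u)` for `m ≥ 0`, and the
coefficient of `u^{-m}` in `Λ⁻(u)` for `m ≤ 0`. -/
def lam (h : 𝔤) (m : ℤ) : ULoop 𝔤 :=
  if 0 ≤ m then PowerSeries.coeff m.natAbs (lambdaPlus h)
  else PowerSeries.coeff m.natAbs (lambdaMinus h)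

/-- The series `X⁻_0(u) = ∑_{m ≥ 0} x⁻_m u^{m+1}`. -/
def xSeries (f : 𝔤) : PowerSeries (ULoop 𝔤) :=
  PowerSeries.mk fun k : ℕ => if k = 0 then 0 else gen f ((k : ℤ) - 1)

end Series

/-- `π⁻(u) = u^{deg π} π(u⁻¹) / (u^{deg π} π(u⁻¹))|_{u = 0}`. -/
def polyMinus (p : ℂ[X]) : ℂ[X] :=
  Polynomial.C (p.reverse.coeff 0)⁻¹ * p.reverse

section Modules

variable {𝔤 : Type*} [LieRing 𝔤] [LieAlgebra ℂ 𝔤] {I : Type*}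

/-- The subalgebra `U(0)` of `U` generated by the `h_{i,m}`, `m ≠ 0`. When the `h i` are the simple
coroots they span the Cartan subalgebra, so this contains all `h_{α,m}` with `m ≠ 0`. -/
def uZero (h : I → 𝔤) : Subalgebra ℂ (ULoop 𝔤) :=
  Algebra.adjoin ℂ {z | ∃ (i : I) (m : ℤ), m ≠ 0 ∧ z = gen (h i) m}

/-- The generators of the left ideal `Ĩ_μ` of `U`, where `h i`, `xp i`, `xm i` are `h_i`, `x_i⁺`,
`x_i⁻` and `μ i = μ(h_i)`:
* `x⁺_{i,m}`;
* `h - μ(h)` for `h` in the Cartan subalgebra (by linearity, `h = h_i` suffices);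
* `Λ_{i,m}` for `|m| > μ(h_i)`;
* `Λ_{i,μ(h_i)} Λ_{i,-m} - Λ_{i,μ(h_i)-m}` for `1 ≤ m ≤ μ(h_i)`;
* `(X̃_i⁻(u) Λ_i⁺(u))_m U(0)` for `m : ℤ`, where `X̃_i⁻(u) = ∑_{m : ℤ} x⁻_{i,m} u^{m+1}`; the
  coefficient is the sum of the `x⁻_{i,m-1-k} Λ_{i,k}` over `k ≥ 0`, in which only the terms with
  `k ≤ μ(h_i)` are kept, the other `Λ_{i,k}` being themselves generators;
* `(X⁻_{i,0}(u)^r Λ_i⁺(u))_m U(0)` for `r ≥ 1` and `m > μ(h_i)`. -/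
def globalRelations (h xp xm : I → 𝔤) (μ : I → ℕ) : Set (ULoop 𝔤) :=
  {z | ∃ (i : I) (m : ℤ), z = gen (xp i) m}
  ∪ {z | ∃ i : I, z = gen (h i) 0 - algebraMap ℂ (ULoop 𝔤) (μ i)}
  ∪ {z | ∃ (i : I) (m : ℤ), (μ i : ℤ) < |m| ∧ z = lam (h i) m}
  ∪ {z | ∃ (i : I) (m : ℕ), 1 ≤ m ∧ m ≤ μ i ∧
      z = lam (h i) (μ i) * lam (h i) (-(m : ℤ)) - lam (h i) ((μ i : ℤ) - m)}
  ∪ {z | ∃ (i : I) (m : ℤ), ∃ y ∈ uZero h,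
      z = (∑ k ∈ Finset.range (μ i + 1), gen (xm i) (m - 1 - k) * lam (h i) k) * y}
  ∪ {z | ∃ (i : I) (r m : ℕ), 1 ≤ r ∧ μ i < m ∧ ∃ y ∈ uZero h,
      z = PowerSeries.coeff m (xSeries (xm i) ^ r * lambdaPlus (h i)) * y}

/-- The `U`-module `W(μ) = U / Ĩ_μ`. -/
abbrev GlobalWeyl (h xp xm : I → 𝔤) (μ : I → ℕ) : Type _ :=
  ULoop 𝔤 ⧸ Submodule.span (ULoop 𝔤) (globalRelations h xp xm μ)

/-- The ideal `I_π(0)` of `U(0)` (as a subset of `U`) generated by the coefficients of the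
`Λ_i^±(u) - π_i^±(u)`. -/
def idealPi (h : I → 𝔤) (π : I → ℂ[X]) : Submodule (uZero h) (ULoop 𝔤) :=
  Submodule.span (uZero h)
    ({z | ∃ (i : I) (s : ℕ), z = PowerSeries.coeff s (lambdaPlus (h i))
        - algebraMap ℂ (ULoop 𝔤) ((π i).coeff s)}
    ∪ {z | ∃ (i : I) (s : ℕ), z = PowerSeries.coeff s (lambdaMinus (h i))
        - algebraMap ℂ (ULoop 𝔤) ((polyMinus (π i)).coeff s)})

/-- `W(μ) · I_π(0)`, for the right action of `U(0)` on `W(μ) = U / Ĩ_μ`: it is the left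
`U`-submodule generated by the images of the elements of `I_π(0)`. -/
def weylKernel (h xp xm : I → 𝔤) (π : I → ℂ[X]) :
    Submodule (ULoop 𝔤) (GlobalWeyl h xp xm fun i => (π i).natDegree) :=
  Submodule.span (ULoop 𝔤)
    (Submodule.Quotient.mk '' (idealPi h π : Set (ULoop 𝔤)))

/-- The Weyl module `W(π) = W(λ_π) ⊗_{U(0)} ℂ_π`, where `ℂ_π = U(0) / I_π(0)` and
`λ_π(h_i) = deg π_i`, written as the quotient `W(λ_π) / W(λ_π) I_π(0)`. -/
def Weyl (h xp xm : I → 𝔤) (π : I → ℂ[X]) : Type _ :=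
  GlobalWeyl h xp xm (fun i => (π i).natDegree) ⧸ weylKernel h xp xm π

variable (h xp xm : I → 𝔤) (π : I → ℂ[X])

attribute [local instance] LieRing.ofAssociativeRing

instance : AddCommGroup (Weyl h xp xm π) :=
  inferInstanceAs (AddCommGroup (_ ⧸ weylKernel h xp xm π))

instance : Module (ULoop 𝔤) (Weyl h xp xm π) :=
  inferInstanceAs (Module (ULoop 𝔤) (_ ⧸ weylKernel h xp xm π))

instance : Module ℂ (Weyl h xp xm π) :=
  Module.compHom _ (algebraMap ℂ (ULoop 𝔤))

instance : IsScalarTower ℂ (ULoop 𝔤) (Weyl h xp xm π) where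
  smul_assoc c z w := by
    change (c • z) • w = algebraMap ℂ (ULoop 𝔤) c • z • w
    rw [Algebra.smul_def, mul_smul]

/-- `L(𝔤)` acts on `W(π)` through `U`. -/
instance : LieRingModule (Loop 𝔤) (Weyl h xp xm π) where
  bracket x w := UniversalEnvelopingAlgebra.ι ℂ x • w
  add_lie x y w := by
    change UniversalEnvelopingAlgebra.ι ℂ (x + y) • w
      = UniversalEnvelopingAlgebra.ι ℂ x • w + UniversalEnvelopingAlgebra.ι ℂ y • w
    rw [map_add, add_smul]
  lie_add x v w := smul_add _ v w
  leibniz_lie x y w := by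
    change UniversalEnvelopingAlgebra.ι ℂ x • UniversalEnvelopingAlgebra.ι ℂ y • w
      = UniversalEnvelopingAlgebra.ι ℂ ⁅x, y⁆ • w
        + UniversalEnvelopingAlgebra.ι ℂ y • UniversalEnvelopingAlgebra.ι ℂ x • w
    rw [LieHom.map_lie, LieRing.of_associative_ring_bracket, sub_smul, mul_smul, mul_smul,
      sub_add_cancel]

instance : LieModule ℂ (Loop 𝔤) (Weyl h xp xm π) where
  smul_lie c x w := by
    change UniversalEnvelopingAlgebra.ι ℂ (c • x) • w
      = c • (UniversalEnvelopingAlgebra.ι ℂ x • w)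
    rw [map_smul, smul_assoc]
  lie_smul c x w := by
    change UniversalEnvelopingAlgebra.ι ℂ x • (algebraMap ℂ (ULoop 𝔤) c • w)
      = algebraMap ℂ (ULoop 𝔤) c • (UniversalEnvelopingAlgebra.ι ℂ x • w)
    rw [← mul_smul, ← mul_smul, Algebra.commutes]

end Modules

end LoopWeyl

end

/-! Write π' for the second tuple. `W(π)` is the universal cyclic module on a Weyl vector of type π:
a vector killed by all `x_i⁺ ⊗ f`, on which `h_i ⊗ f` acts by `∑ f(r⁻¹)` over the roots `r` of
`π_i`, which is killed by `x_i⁻ ⊗ f` for `f` in the ideal `(π_i(t⁻¹))`, and which satisfies the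
power relations. Newton's identities translate the relations on the `Λ_{i,m}` into this form
(`IsWeylVector.apply_eq_zero`, `isWeylVector_weylMk_one`).

No dimension count is needed: both maps of the isomorphism are given by universal properties. In one
direction, the tensor product of the two generators is a Weyl vector of type ππ'
(`IsWeylVector.tmul`), which gives `F : W(ππ') → W(π) ⊗ W(π')`.

For the inverse, put `P = ∏ π_i(t⁻¹)` and `Q = ∏ π'_i(t⁻¹)`. Since the `x_i^±` generate `𝔤`, a power
of `PQ` annihilates `W(ππ')` (`IsWeylVector.exists_annihilator`), so `L(𝔤)` acts there through a
quotient of the Laurent polynomials which the Chinese remainder theorem splits. With `e + e' = 1`,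
`e ∈ (Q^N)` and `e' ∈ (P^N)`, the assignments `x ⊗ f ↦ x ⊗ ef` and `x ⊗ f ↦ x ⊗ e'f` define two
commuting actions whose sum is the given one. The generator is a Weyl vector of type π for the first
and of type π' for the second (`IsWeylVector.twist`), which gives `G : W(π) ⊗ W(π') → W(ππ')`. The
maps `F` and `G` intertwine the actions and exchange the generators, hence are mutually inverse.

The delicate point is the power relations in `IsWeylVector.twist`. They become a partial fraction
statement on generating series (`coeff_pow_mul_eq_zero`): if all powers of `Y + Z` have denominator
`pq`, with `p`, `q` coprime and `Yp`, `Zq` polynomials, then all powers of `Y` have denominator `p`.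
-/

noncomputable section

namespace LoopWeyl

/-! ### Generation of a semisimple Lie algebra by simple root vectors -/

section Generation

open LieAlgebra LieAlgebra.IsKilling LieModule

variable {K L : Type*} [Field K] [CharZero K] [LieRing L] [LieAlgebra K L]
  [FiniteDimensional K L] [IsKilling K L] {H : LieSubalgebra K L} [H.IsCartanSubalgebra]
  [IsTriangularizable K H L]

/-- If `α`, `β` and `α + β` are roots, the bracket of nonzero root vectors for `α` and `β` is
nonzero. -/
lemma lie_ne_zero_of_add_isRoot {α β γ : Weight K H L} (hα : α.IsNonZero) (hβ : β.IsNonZero)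
    (hγ : (γ : H → K) = α + β) {e y : L} (he : e ∈ rootSpace H α) (he0 : e ≠ 0)
    (hy : y ∈ rootSpace H β) (hy0 : y ≠ 0) : ⁅e, y⁆ ≠ 0 := by
  obtain ⟨x, hx, x_ne0⟩ := (chainTop α β).exists_ne_zero
  obtain ⟨h, e', f, isSl2, he', hf⟩ := exists_isSl2Triple_of_weight_isNonZero hα
  obtain rfl := isSl2.h_eq_coroot hα he' hf
  have prim : isSl2.HasPrimitiveVectorWith x (chainLength α β : K) :=
    have := lie_mem_genWeightSpace_of_mem_genWeightSpace he' hx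
    ⟨x_ne0, (chainLength_smul _ _ hx).symm, by rwa [genWeightSpace_add_chainTop _ _ hα] at this⟩
  have h1 : 1 ≤ chainTopCoeff α β := by
    have := ((rootSpace_zsmul_add_ne_bot_iff α β hα 1).mp
      (by rw [one_smul, ← hγ]; exact γ.2)).1
    exact_mod_cast this
  -- The root β lies `n + 1` steps below the top of its α-chain. The vector `f^(n+1) x` therefore
  -- spans its root space, and `e` sends it to `(n+1)(chainLength - n) f^n x`, which is nonzero.
  -- Root spaces are lines, so this one pair decides the general case.
  obtain ⟨n, hn⟩ : ∃ n, chainTopCoeff α β = n + 1 := ⟨_, (Nat.sub_add_cancel h1).symm⟩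
  have hle : n + 1 ≤ chainLength α β := hn ▸ chainTopCoeff_le_chainLength α β
  have key := prim.lie_e_pow_succ_toEnd_f n
  have hz0 : ((toEnd K L L f) ^ n) x ≠ 0 := prim.pow_toEnd_f_ne_zero_of_eq_nat rfl (by omega)
  have hmem : ((toEnd K L L f) ^ (n + 1)) x ∈ rootSpace H β := by
    convert toEnd_pow_apply_mem hf hx (n + 1)
    rw [coe_chainTop, hn]
    ext t
    simp
  have hne : ⁅e', ((toEnd K L L f) ^ (n + 1)) x⁆ ≠ 0 := by
    rw [key]
    refine smul_ne_zero (mul_ne_zero (by exact_mod_cast n.succ_ne_zero) ?_) hz0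
    rw [sub_ne_zero]
    exact_mod_cast (by omega : chainLength α β ≠ n)
  obtain ⟨c, hc⟩ := (finrank_eq_one_iff_of_nonzero' (⟨y, hy⟩ : rootSpace H β)
    (by simpa using! hy0)).mp (finrank_rootSpace_eq_one _ hβ) ⟨_, hmem⟩
  obtain ⟨d, hd⟩ := (finrank_eq_one_iff_of_nonzero' (⟨e, he⟩ : rootSpace H α)
    (by simpa using! he0)).mp (finrank_rootSpace_eq_one _ hα) ⟨_, he'⟩
  replace hc : c • y = ((toEnd K L L f) ^ (n + 1)) x := congrArg Subtype.val hc
  replace hd : d • e = e' := congrArg Subtype.val hd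
  intro h0
  apply hne
  rw [← hc, ← hd, smul_lie, lie_smul, h0, smul_zero, smul_zero]

/-- A Lie subalgebra containing a nonzero element of a root space contains the root space. -/
lemma rootSpace_le_of_mem {α : Weight K H L} (hα : α.IsNonZero) {S : LieSubalgebra K L} {e : L}
    (he : e ∈ rootSpace H α) (he0 : e ≠ 0) (heS : e ∈ S) {y : L} (hy : y ∈ rootSpace H α) :
    y ∈ S := by
  obtain ⟨d, hd⟩ := (finrank_eq_one_iff_of_nonzero' (⟨e, he⟩ : rootSpace H α)
    (by simpa using! he0)).mp (finrank_rootSpace_eq_one _ hα) ⟨_, hy⟩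
  replace hd : d • e = y := congrArg Subtype.val hd
  exact hd ▸ S.smul_mem _ heS

/-- A Lie subalgebra containing all root spaces is everything. -/
lemma eq_top_of_rootSpace_le {S : LieSubalgebra K L}
    (hS : ∀ α : Weight K H L, α.IsNonZero → ∀ y ∈ rootSpace H α, y ∈ S) : S = ⊤ := by
  have hco : ∀ α : Weight K H L, α.IsNonZero → ((coroot α : H) : L) ∈ S := by
    intro α hα
    obtain ⟨h, e, f, isSl2, he, hf⟩ := exists_isSl2Triple_of_weight_isNonZero hα
    obtain rfl := isSl2.h_eq_coroot hα he hf
    rw [← isSl2.lie_e_f]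
    exact S.lie_mem (hS α hα _ he) (hS (-α) hα.neg _ (by simpa using! hf))
  have hH : ∀ x : H, (x : L) ∈ S := by
    intro x
    have hx : x ∈ Submodule.span K (Set.range (rootSystem H).coroot) := by
      rw [RootPairing.IsRootSystem.span_coroot_eq_top]; trivial
    induction hx using Submodule.span_induction with
    | mem x hx =>
      obtain ⟨α, rfl⟩ := hx
      exact hco α.1 (by simpa only [LieSubalgebra.root, Finset.mem_filter_univ] using α.2)
    | zero => exact S.zero_mem
    | add x y _ _ hx hy => exact S.add_mem hx hy
    | smul c x _ hx => exact S.smul_mem c hx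
  have htop := cartan_sup_iSup_rootSpace_eq_top (K := K) (L := L) (H := H)
  rw [← LieSubmodule.toSubmodule_inj] at htop
  simp only [LieSubmodule.sup_toSubmodule, LieSubmodule.iSup_toSubmodule,
    LieSubmodule.top_toSubmodule] at htop
  rw [← LieSubalgebra.toSubmodule_inj, LieSubalgebra.top_toSubmodule, eq_top_iff, ← htop]
  refine sup_le (fun x hx => hH ⟨x, hx⟩) (iSup₂_le fun α hα x hx => hS α hα x hx)

/-- The root vectors for `±` the simple roots generate the Lie algebra. -/
lemma eq_top_of_simple_root_vectors_mem (b : (rootSystem H).Base) (xp xm : b.support → L)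
    (hxp : ∀ i : b.support, xp i ∈ rootSpace H (i.1.1 : H → K))
    (hxm : ∀ i : b.support, xm i ∈ rootSpace H (-(i.1.1 : H → K)))
    (hxp0 : ∀ i, xp i ≠ 0) (hxm0 : ∀ i, xm i ≠ 0) {S : LieSubalgebra K L}
    (hp : ∀ i, xp i ∈ S) (hm : ∀ i, xm i ∈ S) : S = ⊤ := by
  have nz : ∀ k : H.root, k.1.IsNonZero := fun k => by
    simpa only [LieSubalgebra.root, Finset.mem_filter_univ] using k.2
  -- The induction on roots includes a negation step, so `k` and `-k` are treated together.
  suffices h : ∀ k : H.root, (∀ y ∈ rootSpace H k.1, y ∈ S) ∧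
      (∀ y ∈ rootSpace H (-k.1), y ∈ S) by
    refine eq_top_of_rootSpace_le (H := H) fun α hα y hy => ?_
    exact (h ⟨α, by simpa using hα⟩).1 y hy
  intro k
  induction k using b.induction_add with
  | h₀ i ih =>
    have h : ((rootSystem H).reflectionPerm i i).1 = -i.1 := by
      have h2 : (rootSystem H).root ((rootSystem H).reflectionPerm i i) = -(rootSystem H).root i := by
        rw [RootPairing.root_reflectionPerm, RootPairing.reflection_apply_self]
      ext x
      exact LinearMap.congr_fun h2 x
    rw [h, Weight.coe_neg, neg_neg]
    exact ih.symm
  | h₁ i hi =>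
    exact ⟨fun y hy => rootSpace_le_of_mem (nz i) (hxp ⟨i, hi⟩) (hxp0 _) (hp _) hy,
      fun y hy => rootSpace_le_of_mem (nz i).neg (by simpa using! hxm ⟨i, hi⟩) (hxm0 _) (hm _) hy⟩
  | h₂ i j k hk ih hj =>
    have hk' : (k.1 : H → K) = j.1 + i.1 := by
      ext x
      have := LinearMap.congr_fun hk x
      simpa [add_comm] using! this
    have hk'' : ((-k.1 : Weight K H L) : H → K) = (-j.1 : Weight K H L) + (-i.1 : Weight K H L) := by
      simp [hk', add_comm]
    obtain ⟨y, hy, hy0⟩ := i.1.exists_ne_zero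
    obtain ⟨z, hz, hz0⟩ := (-i.1).exists_ne_zero
    have hxm' : xm ⟨j, hj⟩ ∈ rootSpace H (-j.1) := by simpa using! hxm ⟨j, hj⟩
    constructor
    · intro u hu
      refine rootSpace_le_of_mem (nz k) ?_ (lie_ne_zero_of_add_isRoot (nz j) (nz i) hk'
        (hxp ⟨j, hj⟩) (hxp0 _) hy hy0) (S.lie_mem (hp _) (ih.1 y hy)) hu
      rw [hk']
      exact lie_mem_genWeightSpace_of_mem_genWeightSpace (hxp ⟨j, hj⟩) hy
    · intro u hu
      refine rootSpace_le_of_mem (nz k).neg ?_ (lie_ne_zero_of_add_isRoot (nz j).neg (nz i).neg hk''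
        hxm' (hxm0 _) hz hz0) (S.lie_mem (hm _) (ih.2 z (by simpa using! hz))) hu
      rw [hk'']
      exact lie_mem_genWeightSpace_of_mem_genWeightSpace hxm' hz

end Generation

universe v

/-! ### Newton's identities for exponential series and for products of linear factors -/

section Newton

open PowerSeries Finset

open scoped IsMulCommutative in
/-- Commuting elements of an algebra come from a commutative algebra. -/
lemma exists_commRing_lift {A : Type v} [Ring A] [Algebra ℂ A] {ι : Type*} (g : ι → A)
    (hg : ∀ j k, Commute (g j) (g k)) :
    ∃ (B : Type v) (_ : CommRing B) (_ : Algebra ℂ B) (φ : B →ₐ[ℂ] A) (g' : ι → B),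
      ∀ i, φ (g' i) = g i :=
  have : IsMulCommutative (Algebra.adjoin ℂ (Set.range g)) :=
    Algebra.isMulCommutative_adjoin ℂ (by rintro _ ⟨j, rfl⟩ _ ⟨k, rfl⟩; exact hg j k)
  ⟨Algebra.adjoin ℂ (Set.range g), inferInstance, inferInstance,
    (Algebra.adjoin ℂ (Set.range g)).val, fun k => ⟨g k, Algebra.subset_adjoin ⟨k, rfl⟩⟩,
    fun _ => rfl⟩

lemma coeff_zero_expSeries {A : Type*} [Ring A] [Algebra ℂ A] (F : PowerSeries A) :
    coeff 0 (expSeries F) = 1 := by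
  simp [expSeries]

lemma coeff_expSeries_map {A B : Type*} [Ring A] [Algebra ℂ A] [Ring B] [Algebra ℂ B]
    (φ : A →ₐ[ℂ] B) (F : PowerSeries A) (m : ℕ) :
    coeff m (expSeries (PowerSeries.map (φ : A →+* B) F)) = φ (coeff m (expSeries F)) := by
  simp only [expSeries, coeff_mk, map_sum, map_smul, ← map_pow, coeff_map, RingHom.coe_coe]

/-- The logarithmic derivative of the exponential series, over a commutative ring. -/
lemma coeff_succ_expSeries {B : Type*} [CommRing B] [Algebra ℂ B] {F : PowerSeries B}
    (hF : constantCoeff F = 0) (k : ℕ) :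
    coeff (k + 1) (expSeries F) * ((k : B) + 1) =
      ∑ p ∈ antidiagonal k, coeff (p.1 + 1) F * ((p.1 : B) + 1) * coeff p.2 (expSeries F) := by
  -- As `F` has no constant term, `F ^ j` does not reach degree `m` when `j > m`; the
  -- coefficientwise exponential can thus be differentiated as a finite sum.
  have trunc : ∀ N m, m < N → coeff m (expSeries F) =
      coeff m (∑ j ∈ range N, ((j.factorial : ℂ)⁻¹) • F ^ j) := by
    intro N m hm
    simp only [expSeries, coeff_mk, map_sum, coeff_smul]
    refine sum_subset (range_mono hm) fun j _ hj => ?_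
    rw [coeff_of_lt_order, smul_zero]
    refine lt_of_lt_of_le ?_ (le_order_pow_of_constantCoeff_eq_zero j hF)
    rw [mem_range, not_lt] at hj
    exact_mod_cast hj
  have hD : ∀ N, derivative B (∑ j ∈ range (N + 1), ((j.factorial : ℂ)⁻¹) • F ^ j) =
      derivative B F * ∑ j ∈ range N, ((j.factorial : ℂ)⁻¹) • F ^ j := by
    intro N
    rw [map_sum, sum_range_succ', mul_sum]
    have hs : ∀ (c : ℂ) (G : PowerSeries B), derivative B (c • G) = c • derivative B G := by
      intro c G
      ext n
      simp [coeff_derivative]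
    simp only [hs]
    have h0 : derivative B (F ^ 0) = 0 := by rw [pow_zero]; exact Derivation.map_one_eq_zero _
    rw [h0, smul_zero, add_zero]
    refine sum_congr rfl fun j _ => ?_
    rw [Derivation.leibniz_pow, mul_smul_comm, Nat.add_sub_cancel, smul_eq_mul, mul_comm (F ^ j),
      ← Nat.cast_smul_eq_nsmul ℂ, smul_smul, Nat.factorial_succ]
    congr 1
    have : ((j : ℂ) + 1) ≠ 0 := by exact_mod_cast j.succ_ne_zero
    have : (j.factorial : ℂ) ≠ 0 := by exact_mod_cast j.factorial_ne_zero
    push_cast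
    field_simp
  rw [trunc (k + 2) (k + 1) (by omega), ← coeff_derivative, hD, coeff_mul]
  refine sum_congr rfl fun p hp => ?_
  rw [coeff_derivative, trunc (k + 1) p.2 (by rw [HasAntidiagonal.mem_antidiagonal] at hp; omega)]

/-- Newton's identities for `exp (- ∑ g_k u^k / k)`, where the `g_k` come from a commutative
algebra. -/
lemma newton_expSeries_map {A B : Type*} [CommRing B] [Algebra ℂ B] [Ring A] [Algebra ℂ A]
    (φ : B →ₐ[ℂ] A) (g : ℕ → B) (k : ℕ) :
    ((k : ℂ) + 1) • coeff (k + 1)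
        (expSeries (-PowerSeries.mk fun k : ℕ => if k = 0 then 0 else ((k : ℂ)⁻¹) • φ (g k))) =
      -∑ a ∈ range (k + 1), coeff (k - a)
        (expSeries (-PowerSeries.mk fun k : ℕ => if k = 0 then 0 else ((k : ℂ)⁻¹) • φ (g k)))
          * φ (g (a + 1)) := by
  let F : PowerSeries B :=
    -PowerSeries.mk fun k : ℕ => if k = 0 then 0 else ((k : ℂ)⁻¹) • g k
  have hF : PowerSeries.map (φ : B →+* A) F =
      -PowerSeries.mk fun k : ℕ => if k = 0 then 0 else ((k : ℂ)⁻¹) • φ (g k) := by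
    ext n
    simp only [F, map_neg, coeff_map, coeff_mk]
    split_ifs <;> simp
  rw [← hF]
  simp only [coeff_expSeries_map]
  have hF0 : constantCoeff F = 0 := by
    rw [← coeff_zero_eq_constantCoeff_apply]; simp [F]
  have key := coeff_succ_expSeries hF0 k
  rw [Nat.sum_antidiagonal_eq_sum_range_succ_mk] at key
  have hc : ∀ a : ℕ, coeff (a + 1) F * ((a : B) + 1) = -g (a + 1) := by
    intro a
    have h1 : ((a : ℂ) + 1) ≠ 0 := by exact_mod_cast a.succ_ne_zero
    have h2 : ((a : B) + 1) = algebraMap ℂ B ((a : ℂ) + 1) := by simp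
    rw [h2, mul_comm, ← Algebra.smul_def]
    simp [F, smul_smul, mul_inv_cancel₀ h1]
  simp only [hc, neg_mul, sum_neg_distrib] at key
  have h2 : ((k : B) + 1) = algebraMap ℂ B ((k : ℂ) + 1) := by simp
  rw [h2, mul_comm, ← Algebra.smul_def] at key
  have := congrArg φ key
  rw [map_smul, map_neg, map_sum] at this
  rw [this]
  congr 1
  refine sum_congr rfl fun a _ => ?_
  rw [mul_comm, map_mul]

/-- Newton's identities for `exp (- ∑ g_k u^k / k)`. -/
lemma newton_expSeries {A : Type*} [Ring A] [Algebra ℂ A] (g : ℕ → A)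
    (hg : ∀ j k, Commute (g j) (g k)) (k : ℕ) :
    ((k : ℂ) + 1) • coeff (k + 1)
        (expSeries (-PowerSeries.mk fun k : ℕ => if k = 0 then 0 else ((k : ℂ)⁻¹) • g k)) =
      -∑ a ∈ range (k + 1), coeff (k - a)
        (expSeries (-PowerSeries.mk fun k : ℕ => if k = 0 then 0 else ((k : ℂ)⁻¹) • g k))
          * g (a + 1) := by
  obtain ⟨B, _, _, φ, g', h⟩ := exists_commRing_lift g hg
  obtain rfl : (fun k => φ (g' k)) = g := funext h
  exact newton_expSeries_map φ g' k

/-- Newton's recursion is triangular: `g (k+1)` occurs in it with coefficient `coeff 0 E = 1`, all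
other terms having smaller index. Strong induction thus passes from the eigenvalues of one family to
those of the other. -/
lemma expSeries_eigenvector_iff {A M : Type*} [Ring A] [Algebra ℂ A] [AddCommGroup M] [Module ℂ M]
    (ρ : A →ₐ[ℂ] Module.End ℂ M) (w : M) (g : ℕ → A) (hg : ∀ j k, Commute (g j) (g k))
    {q c : ℕ → ℂ} (hq0 : q 0 = 1)
    (hq : ∀ k : ℕ, ((k : ℂ) + 1) * q (k + 1) = -∑ a ∈ range (k + 1), q (k - a) * c (a + 1)) :
    (∀ k, ρ (coeff k (expSeries
      (-PowerSeries.mk fun k : ℕ => if k = 0 then 0 else ((k : ℂ)⁻¹) • g k))) w = q k • w) ↔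
    ∀ k, ρ (g (k + 1)) w = c (k + 1) • w := by
  have newton := newton_expSeries g hg
  set E := expSeries (-PowerSeries.mk fun k : ℕ => if k = 0 then 0 else ((k : ℂ)⁻¹) • g k)
  have hE0 : coeff 0 E = 1 := coeff_zero_expSeries _
  have newton' : ∀ k : ℕ, ((k : ℂ) + 1) • ρ (coeff (k + 1) E) w =
      -∑ a ∈ range (k + 1), ρ (coeff (k - a) E) (ρ (g (a + 1)) w) := by
    intro k
    have := congrArg (fun x => ρ x w) (newton k)
    simpa [map_sum, LinearMap.sum_apply] using this
  constructor
  · intro h k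
    induction k using Nat.strong_induction_on with
    | _ k ih =>
      have h1 := newton' k
      rw [sum_range_succ, Nat.sub_self, hE0, map_one, Module.End.one_apply, h, smul_smul, hq k,
        sum_range_succ, Nat.sub_self, hq0, one_mul,
        sum_congr rfl (g := fun a => (q (k - a) * c (a + 1)) • w) (fun a ha => by
          rw [ih a (mem_range.mp ha), map_smul, h, smul_smul, mul_comm]), ← sum_smul,
        neg_smul, add_smul, neg_inj, add_right_inj] at h1
      exact h1.symm
  · intro h k
    induction k using Nat.strong_induction_on with
    | _ k ih =>
      rcases k with _ | k
      · rw [hE0, hq0, map_one, one_smul, Module.End.one_apply]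
      · have h1 := newton' k
        rw [sum_congr rfl (g := fun a => (q (k - a) * c (a + 1)) • w) (fun a ha => by
          rw [h, map_smul, ih (k - a) (by omega), smul_smul, mul_comm]), ← sum_smul,
          ← neg_smul, ← hq k, mul_smul] at h1
        exact smul_right_injective M
          (by exact_mod_cast k.succ_ne_zero : ((k : ℂ) + 1) ≠ 0) h1

/-- Newton's identities for `∏ (1 - a u)`. -/
lemma newton_prod (s : Multiset ℂ) (k : ℕ) :
    ((k : ℂ) + 1) * ((s.map fun a => (1 - Polynomial.C a * Polynomial.X : ℂ[X])).prod).coeff (k + 1)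
      = -∑ a ∈ range (k + 1),
        ((s.map fun a => (1 - Polynomial.C a * Polynomial.X : ℂ[X])).prod).coeff (k - a) *
          (s.map fun x => x ^ (a + 1)).sum := by
  -- The logarithmic derivative of `∏ (1 - a u)` is `-∑ a / (1 - a u)`, the generating series of the
  -- power sums up to sign.
  have main : ∀ s : Multiset ℂ,
      derivative ℂ ((s.map fun a => (1 - Polynomial.C a * Polynomial.X : ℂ[X])).prod : PowerSeries ℂ)
        = -((PowerSeries.mk fun k => (s.map fun x => x ^ (k + 1)).sum) *
          ((s.map fun a => (1 - Polynomial.C a * Polynomial.X : ℂ[X])).prod : PowerSeries ℂ)) := by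
    intro s
    induction s using Multiset.induction_on with
    | empty =>
      have : (PowerSeries.mk fun k => ((0 : Multiset ℂ).map fun x => x ^ (k + 1)).sum) = 0 := by
        ext; simp
      rw [this]
      simp
    | cons a s ih =>
      have hmk : (PowerSeries.mk fun k => ((a ::ₘ s).map fun x => x ^ (k + 1)).sum) =
          (PowerSeries.mk fun k => a ^ (k + 1)) +
            PowerSeries.mk fun k => (s.map fun x => x ^ (k + 1)).sum := by
        ext; simp
      have hgeo : (1 - PowerSeries.C a * X) * (PowerSeries.mk fun k => a ^ (k + 1)) =
          PowerSeries.C a := by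
        ext n
        rw [sub_mul, one_mul, map_sub, mul_assoc, coeff_C_mul]
        rcases n with _ | n
        · simp
        · rw [coeff_succ_X_mul, coeff_mk, coeff_mk, coeff_C]
          simp; ring
      rw [Multiset.map_cons, Multiset.prod_cons, Polynomial.coe_mul, Derivation.leibniz, ih, hmk]
      have hco : ((1 - Polynomial.C a * Polynomial.X : ℂ[X]) : PowerSeries ℂ) =
          1 - PowerSeries.C a * X := by simp
      have hd : derivative ℂ (1 - PowerSeries.C a * X : PowerSeries ℂ) = -PowerSeries.C a := by
        ext n
        rw [coeff_derivative]
        rcases n with _ | n <;> simp [coeff_one, coeff_C]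
      rw [hco, hd, smul_eq_mul, smul_eq_mul]
      linear_combination
        ((s.map fun a => (1 - Polynomial.C a * Polynomial.X : ℂ[X])).prod : PowerSeries ℂ) * hgeo
  have h := congrArg (coeff k) (main s)
  rw [coeff_derivative, map_neg, coeff_mul, Nat.sum_antidiagonal_eq_sum_range_succ_mk] at h
  simp only [Polynomial.coeff_coe, coeff_mk] at h
  rw [mul_comm, h]
  simp only [mul_comm]

end Newton

/-! ### Power sums of the roots of a polynomial with constant term one -/

section PowerSums

open Polynomial

/-- The power sums `∑ r^{-m}` over the roots `r` of `p`. -/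
def powerSum (p : ℂ[X]) (m : ℤ) : ℂ := (p.roots.map fun r => r ^ (-m)).sum

lemma root_ne_zero {p : ℂ[X]} (hp : p.coeff 0 = 1) {r : ℂ} (hr : r ∈ p.roots) : r ≠ 0 := by
  rintro rfl
  have := (mem_roots'.mp hr).2
  rw [IsRoot.def, ← coeff_zero_eq_eval_zero, hp] at this
  exact one_ne_zero this

/-- Evaluating the factorization at zero shows that the leading coefficient cancels the product of
the `-r`. -/
lemma eq_prod_one_sub_inv {p : ℂ[X]} (hp : p.coeff 0 = 1) :
    p = ((p.roots.map fun r => r⁻¹).map fun a => 1 - C a * X).prod := by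
  have h := (IsAlgClosed.splits p).eq_prod_roots
  have hl : p.leadingCoeff * (p.roots.map fun r => -r).prod = 1 := by
    conv_rhs => rw [← hp, coeff_zero_eq_eval_zero, h]
    rw [eval_mul, eval_C, eval_multiset_prod, Multiset.map_map]
    simp
  have h2 : ∀ s : Multiset ℂ, (∀ r ∈ s, r ≠ 0) → (s.map fun r => X - C r).prod =
      C (s.map fun r => -r).prod * ((s.map fun r => r⁻¹).map fun a => 1 - C a * X).prod := by
    intro s
    induction s using Multiset.induction_on with
    | empty => simp
    | cons a s ih =>
      intro hs
      have ha : a ≠ 0 := hs a (Multiset.mem_cons_self a s)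
      have h3 : (X - C a : ℂ[X]) = C (-a) * (1 - C a⁻¹ * X) := by
        have : (C a * C a⁻¹ : ℂ[X]) = 1 := by rw [← C_mul, mul_inv_cancel₀ ha, C_1]
        rw [C_neg]
        linear_combination (-X) * this
      simp only [Multiset.map_cons, Multiset.prod_cons,
        ih fun r hr => hs r (Multiset.mem_cons_of_mem hr), h3, C_mul]
      ring
  conv_lhs => rw [h, h2 _ fun r hr => root_ne_zero hp hr, ← mul_assoc, ← C_mul, hl, C_1, one_mul]

/-- Reversal is multiplicative and turns `X - r` into `1 - r X`; the normalization removes the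
leading coefficient. So π⁻ has the power sums of the roots where π has those of their inverses. -/
lemma polyMinus_eq_prod {p : ℂ[X]} (hp : p.coeff 0 = 1) :
    polyMinus p = (p.roots.map fun a => 1 - C a * X).prod := by
  have hp0 : p ≠ 0 := by rintro rfl; simp at hp
  have h := (IsAlgClosed.splits p).eq_prod_roots
  have hr : ∀ s : Multiset ℂ, (s.map fun r => (X - C r : ℂ[X])).prod.reverse =
      (s.map fun a => 1 - C a * X).prod := by
    intro s
    induction s using Multiset.induction_on with
    | empty => simpa using reverse_C (1 : ℂ)
    | cons a s ih =>
      simp only [Multiset.map_cons, Multiset.prod_cons, reverse_mul_of_domain, ih]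
      congr 1
      ext n
      rw [coeff_reverse, natDegree_X_sub_C]
      rcases n with _ | _ | n
      · simp
      · simp [coeff_one]
      · rw [revAt_eq_self_of_lt (by omega)]
        simp [coeff_one, coeff_X]
  rw [polyMinus, coeff_zero_reverse]
  conv_lhs => rw [h, leadingCoeff_mul, leadingCoeff_C, reverse_mul_of_domain, reverse_C, hr]
  rw [(monic_multiset_prod_of_monic _ _ fun r _ => monic_X_sub_C r).leadingCoeff, mul_one, ← mul_assoc, ← C_mul,
    inv_mul_cancel₀ (leadingCoeff_ne_zero.mpr hp0), C_1, one_mul]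

lemma newton_coeff {p : ℂ[X]} (hp : p.coeff 0 = 1) (k : ℕ) :
    ((k : ℂ) + 1) * p.coeff (k + 1) =
      -∑ a ∈ Finset.range (k + 1), p.coeff (k - a) * powerSum p ((a + 1 : ℕ) : ℤ) := by
  have h := newton_prod (p.roots.map fun r => r⁻¹) k
  rw [← eq_prod_one_sub_inv hp] at h
  rw [h]
  simp only [powerSum, zpow_neg, zpow_natCast, Multiset.map_map, Function.comp_def, inv_pow]

lemma newton_coeff_polyMinus {p : ℂ[X]} (hp : p.coeff 0 = 1) (k : ℕ) :
    ((k : ℂ) + 1) * (polyMinus p).coeff (k + 1) =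
      -∑ a ∈ Finset.range (k + 1),
        (polyMinus p).coeff (k - a) * powerSum p (-((a + 1 : ℕ) : ℤ)) := by
  have h := newton_prod p.roots k
  rw [← polyMinus_eq_prod hp] at h
  rw [h]
  simp only [powerSum, neg_neg, zpow_natCast]

lemma coeff_zero_polyMinus {p : ℂ[X]} (hp : p ≠ 0) : (polyMinus p).coeff 0 = 1 := by
  rw [polyMinus, coeff_C_mul, coeff_zero_reverse, inv_mul_cancel₀ (leadingCoeff_ne_zero.mpr hp)]

/-- This puts the weight condition on `h_{i,0}` into the same formula as the eigenvalues of the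
other `h_{i,m}`. -/
lemma powerSum_zero (p : ℂ[X]) : powerSum p 0 = p.natDegree := by
  simp [powerSum, (IsAlgClosed.splits p).natDegree_eq_card_roots]

lemma powerSum_mul {p q : ℂ[X]} (hpq : p * q ≠ 0) (m : ℤ) :
    powerSum (p * q) m = powerSum p m + powerSum q m := by
  simp [powerSum, roots_mul hpq]

end PowerSums

/-! ### Weyl vectors and the universal property of the Weyl module -/

section WeylVector

open Finset

attribute [local instance] LieRing.ofAssociativeRing

variable {𝔤 : Type*} [LieRing 𝔤] [LieAlgebra ℂ 𝔤] {I : Type*}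

lemma gen_commute {x y : 𝔤} (hxy : ⁅x, y⁆ = 0) (m n : ℤ) : Commute (gen x m) (gen y n) := by
  have h : UniversalEnvelopingAlgebra.ι ℂ
      ⁅((LaurentPolynomial.T m : LaurentPolynomial ℂ) ⊗ₜ[ℂ] x : Loop 𝔤),
        ((LaurentPolynomial.T n : LaurentPolynomial ℂ) ⊗ₜ[ℂ] y : Loop 𝔤)⁆ = 0 := by
    rw [LieAlgebra.ExtendScalars.bracket_tmul, hxy, TensorProduct.tmul_zero, map_zero]
  rw [LieHom.map_lie, LieRing.of_associative_ring_bracket, sub_eq_zero] at h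
  exact h

variable {M : Type*} [AddCommGroup M] [Module ℂ M]

/-- The annihilator of a vector, as a left ideal of the enveloping algebra. -/
def annIdeal (ρ : ULoop 𝔤 →ₐ[ℂ] Module.End ℂ M) (w : M) : Submodule (ULoop 𝔤) (ULoop 𝔤) where
  carrier := {a | ρ a w = 0}
  add_mem' {a b} ha hb := by
    rw [Set.mem_ofPred_eq] at *
    rw [map_add, LinearMap.add_apply, ha, hb, add_zero]
  zero_mem' := by simp
  smul_mem' c a ha := by
    rw [Set.mem_ofPred_eq] at *
    rw [smul_eq_mul, map_mul, Module.End.mul_apply, ha, map_zero]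

lemma mem_annIdeal {ρ : ULoop 𝔤 →ₐ[ℂ] Module.End ℂ M} {w : M} {a : ULoop 𝔤} :
    a ∈ annIdeal ρ w ↔ ρ a w = 0 := Iff.rfl

variable (h xp xm : I → 𝔤)

/-- Vectors satisfying the relations of the generator of `W(π)`, in terms of the eigenvalues of
the `h_{i,m}`. -/
structure IsWeylVector (ρ : ULoop 𝔤 →ₐ[ℂ] Module.End ℂ M) (w : M) (π : I → ℂ[X]) : Prop where
  raising : ∀ i m, ρ (gen (xp i) m) w = 0
  cartan : ∀ i m, ρ (gen (h i) m) w = powerSum (π i) m • w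
  lowering : ∀ i (m : ℤ), ∑ k ∈ range ((π i).natDegree + 1),
    (π i).coeff k • ρ (gen (xm i) (m - 1 - k)) w = 0
  -- The exponent `r = 0` is allowed because it occurs in binomial expansions; it holds for degree
  -- reasons.
  power : ∀ i r m, (π i).natDegree < m → ∑ p ∈ antidiagonal m,
    (π i).coeff p.2 • ρ (PowerSeries.coeff p.1 (xSeries (xm i) ^ r)) w = 0

variable {h xp xm}

lemma lambdaPlus_eigenvector_iff (ρ : ULoop 𝔤 →ₐ[ℂ] Module.End ℂ M) (w : M) (x : 𝔤)
    {p : ℂ[X]} (hp : p.coeff 0 = 1) :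
    (∀ k, ρ (PowerSeries.coeff k (lambdaPlus x)) w = p.coeff k • w) ↔
      ∀ k : ℕ, ρ (gen x ((k + 1 : ℕ) : ℤ)) w = powerSum p ((k + 1 : ℕ) : ℤ) • w :=
  expSeries_eigenvector_iff ρ w (fun k : ℕ => gen x (k : ℤ))
    (fun _ _ => gen_commute (lie_self x) _ _) (c := fun k => powerSum p (k : ℤ)) hp
    (newton_coeff hp)

lemma lambdaMinus_eigenvector_iff (ρ : ULoop 𝔤 →ₐ[ℂ] Module.End ℂ M) (w : M) (x : 𝔤)
    {p : ℂ[X]} (hp : p.coeff 0 = 1) :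
    (∀ k, ρ (PowerSeries.coeff k (lambdaMinus x)) w = (polyMinus p).coeff k • w) ↔
      ∀ k : ℕ, ρ (gen x (-((k + 1 : ℕ) : ℤ))) w = powerSum p (-((k + 1 : ℕ) : ℤ)) • w :=
  expSeries_eigenvector_iff ρ w (fun k : ℕ => gen x (-(k : ℤ)))
    (fun _ _ => gen_commute (lie_self x) _ _) (c := fun k => powerSum p (-(k : ℤ)))
    (coeff_zero_polyMinus (by rintro rfl; simp at hp)) (newton_coeff_polyMinus hp)

lemma coeff_polyMinus (p : ℂ[X]) (s : ℕ) :
    (polyMinus p).coeff s = p.leadingCoeff⁻¹ * p.coeff (Polynomial.revAt p.natDegree s) := by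
  rw [polyMinus, Polynomial.coeff_C_mul, Polynomial.coeff_zero_reverse, Polynomial.coeff_reverse]

namespace IsWeylVector

variable {ρ : ULoop 𝔤 →ₐ[ℂ] Module.End ℂ M} {w : M} {π : I → ℂ[X]}

lemma lambdaPlus_apply (H : IsWeylVector h xp xm ρ w π) (hπ : ∀ i, (π i).coeff 0 = 1) (i : I)
    (k : ℕ) : ρ (PowerSeries.coeff k (lambdaPlus (h i))) w = (π i).coeff k • w :=
  (lambdaPlus_eigenvector_iff ρ w (h i) (hπ i)).mpr (fun _ => H.cartan i _) k

lemma lambdaMinus_apply (H : IsWeylVector h xp xm ρ w π) (hπ : ∀ i, (π i).coeff 0 = 1) (i : I)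
    (k : ℕ) : ρ (PowerSeries.coeff k (lambdaMinus (h i))) w = (polyMinus (π i)).coeff k • w :=
  (lambdaMinus_eigenvector_iff ρ w (h i) (hπ i)).mpr (fun _ => H.cartan i _) k

lemma lam_natCast_apply (H : IsWeylVector h xp xm ρ w π) (hπ : ∀ i, (π i).coeff 0 = 1) (i : I)
    (k : ℕ) : ρ (lam (h i) k) w = (π i).coeff k • w := by
  rw [lam, if_pos (Int.natCast_nonneg k), Int.natAbs_natCast, H.lambdaPlus_apply hπ]

lemma lam_neg_apply (H : IsWeylVector h xp xm ρ w π) (hπ : ∀ i, (π i).coeff 0 = 1) (i : I)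
    {k : ℕ} (hk : 1 ≤ k) : ρ (lam (h i) (-(k : ℤ))) w = (polyMinus (π i)).coeff k • w := by
  rw [lam, if_neg (by omega), Int.natAbs_neg, Int.natAbs_natCast, H.lambdaMinus_apply hπ]

/-- Takes care of the right factors from `U(0)` in the last two families of relations: they only
rescale `w`. -/
lemma uZero_apply (H : IsWeylVector h xp xm ρ w π) {y : ULoop 𝔤} (hy : y ∈ uZero h) :
    ∃ c : ℂ, ρ y w = c • w := by
  induction hy using Algebra.adjoin_induction with
  | mem x hx =>
    obtain ⟨i, m, -, rfl⟩ := hx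
    exact ⟨_, H.cartan i m⟩
  | algebraMap r => exact ⟨r, by rw [AlgHom.commutes, Module.algebraMap_end_apply]⟩
  | add x y _ _ hx hy =>
    obtain ⟨a, ha⟩ := hx
    obtain ⟨b, hb⟩ := hy
    exact ⟨a + b, by rw [map_add, LinearMap.add_apply, ha, hb, add_smul]⟩
  | mul x y _ _ hx hy =>
    obtain ⟨a, ha⟩ := hx
    obtain ⟨b, hb⟩ := hy
    exact ⟨b * a, by rw [map_mul, Module.End.mul_apply, hb, map_smul, ha, smul_smul]⟩

lemma globalRelations_subset (H : IsWeylVector h xp xm ρ w π) (hπ : ∀ i, (π i).coeff 0 = 1) :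
    globalRelations h xp xm (fun i => (π i).natDegree) ⊆ annIdeal ρ w := by
  have hne : ∀ i, π i ≠ 0 := fun i h0 => by simpa [h0] using hπ i
  rintro z (((((⟨i, m, rfl⟩ | ⟨i, rfl⟩) | ⟨i, m, hm, rfl⟩) | ⟨i, m, hm1, hm2, rfl⟩) |
    ⟨i, m, y, hy, rfl⟩) | ⟨i, r, m, -, hm, y, hy, rfl⟩) <;>
    rw [SetLike.mem_coe, mem_annIdeal]
  · exact H.raising i m
  · rw [map_sub, LinearMap.sub_apply, H.cartan, AlgHom.commutes, Module.algebraMap_end_apply,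
      powerSum_zero, sub_self]
  · rcases le_or_gt 0 m with h0 | h0
    · obtain ⟨k, rfl⟩ := Int.eq_ofNat_of_zero_le h0
      rw [H.lam_natCast_apply hπ, Polynomial.coeff_eq_zero_of_natDegree_lt (by simpa using hm),
        zero_smul]
    · obtain ⟨k, hk⟩ := Int.eq_ofNat_of_zero_le (by omega : 0 ≤ -m)
      obtain rfl : m = -(k : ℤ) := by omega
      have hlt : (π i).natDegree < k := by simpa using hm
      rw [H.lam_neg_apply hπ i (by omega), coeff_polyMinus, Polynomial.revAt_eq_self_of_lt hlt,
        Polynomial.coeff_eq_zero_of_natDegree_lt hlt, mul_zero, zero_smul]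
  -- The coefficient of `u^m` in π⁻ is that of `u^(deg π - m)` in π divided by the leading
  -- coefficient, and the latter is the eigenvalue of `Λ_{i,deg π}`.
  · have hlc : (π i).leadingCoeff ≠ 0 := Polynomial.leadingCoeff_ne_zero.mpr (hne i)
    rw [map_sub, LinearMap.sub_apply, map_mul, Module.End.mul_apply, H.lam_neg_apply hπ i hm1,
      map_smul, H.lam_natCast_apply hπ, ← Nat.cast_sub hm2, H.lam_natCast_apply hπ,
      coeff_polyMinus, Polynomial.revAt_le hm2, smul_smul, ← sub_smul,
      Polynomial.coeff_natDegree, mul_right_comm, inv_mul_cancel₀ hlc, one_mul, sub_self, zero_smul]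
  · obtain ⟨c, hc⟩ := H.uZero_apply hy
    rw [map_mul, Module.End.mul_apply, hc, map_smul, map_sum, LinearMap.sum_apply]
    simp only [map_mul, Module.End.mul_apply, H.lam_natCast_apply hπ, map_smul]
    rw [H.lowering, smul_zero]
  · obtain ⟨c, hc⟩ := H.uZero_apply hy
    rw [map_mul, Module.End.mul_apply, hc, map_smul, PowerSeries.coeff_mul, map_sum,
      LinearMap.sum_apply]
    simp only [map_mul, Module.End.mul_apply, H.lambdaPlus_apply hπ, map_smul]
    rw [H.power i r m hm, smul_zero]

lemma idealPi_subset (H : IsWeylVector h xp xm ρ w π) (hπ : ∀ i, (π i).coeff 0 = 1) :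
    (idealPi h π : Set (ULoop 𝔤)) ⊆ annIdeal ρ w := by
  suffices hle : idealPi h π ≤ (annIdeal ρ w).restrictScalars (uZero h) from hle
  refine Submodule.span_le.mpr ?_
  rintro z (⟨i, s, rfl⟩ | ⟨i, s, rfl⟩) <;>
    rw [SetLike.mem_coe, Submodule.restrictScalars_mem, mem_annIdeal, map_sub, LinearMap.sub_apply,
      AlgHom.commutes, Module.algebraMap_end_apply]
  · rw [H.lambdaPlus_apply hπ, sub_self]
  · rw [H.lambdaMinus_apply hπ, sub_self]

end IsWeylVector

variable (h xp xm) (π : I → ℂ[X])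

/-- The quotient map `U → W(π)`. -/
def weylMk : ULoop 𝔤 →ₗ[ULoop 𝔤] Weyl h xp xm π :=
  (weylKernel h xp xm π).mkQ ∘ₗ
    (Submodule.span (ULoop 𝔤) (globalRelations h xp xm fun i => (π i).natDegree)).mkQ

lemma weylMk_surjective : Function.Surjective (weylMk h xp xm π) :=
  (Submodule.mkQ_surjective _).comp (Submodule.mkQ_surjective _)

lemma weylMk_eq_zero_iff (a : ULoop 𝔤) : weylMk h xp xm π a = 0 ↔
    Submodule.Quotient.mk a ∈ weylKernel h xp xm π :=
  Submodule.Quotient.mk_eq_zero _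

lemma weylMk_globalRelations {a : ULoop 𝔤}
    (ha : a ∈ globalRelations h xp xm fun i => (π i).natDegree) : weylMk h xp xm π a = 0 := by
  rw [weylMk_eq_zero_iff, (Submodule.Quotient.mk_eq_zero _).mpr (Submodule.subset_span ha)]
  exact zero_mem _

lemma weylMk_idealPi {a : ULoop 𝔤} (ha : a ∈ idealPi h π) : weylMk h xp xm π a = 0 := by
  rw [weylMk_eq_zero_iff]
  exact Submodule.subset_span ⟨a, ha, rfl⟩

variable {h xp xm π}

/-- Universal property of `W(π)`: the annihilator of `w` is a left ideal containing both sets of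
generators, hence the whole kernel of `U → W(π)`. -/
lemma IsWeylVector.apply_eq_zero {ρ : ULoop 𝔤 →ₐ[ℂ] Module.End ℂ M} {w : M}
    (H : IsWeylVector h xp xm ρ w π) (hπ : ∀ i, (π i).coeff 0 = 1) {a : ULoop 𝔤}
    (ha : weylMk h xp xm π a = 0) : ρ a w = 0 := by
  rw [weylMk_eq_zero_iff] at ha
  set J := Submodule.span (ULoop 𝔤) (globalRelations h xp xm fun i => (π i).natDegree)
  have hJ : J ≤ annIdeal ρ w := Submodule.span_le.mpr (H.globalRelations_subset hπ)
  have hK : weylKernel h xp xm π ≤ (annIdeal ρ w).map J.mkQ := by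
    refine Submodule.span_le.mpr ?_
    rintro _ ⟨b, hb, rfl⟩
    exact ⟨b, H.idealPi_subset hπ hb, rfl⟩
  obtain ⟨b, hb, hab⟩ := hK ha
  have hsub : b - a ∈ J := (Submodule.Quotient.eq J).mp hab
  have := (annIdeal ρ w).sub_mem hb (hJ hsub)
  rwa [sub_sub_cancel] at this

variable (h xp xm π)

/-- The action of `U` on `W(π)`. -/
abbrev weylRep : ULoop 𝔤 →ₐ[ℂ] Module.End ℂ (Weyl h xp xm π) :=
  Algebra.lsmul ℂ ℂ (Weyl h xp xm π)

lemma weylRep_mk_one (a : ULoop 𝔤) :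
    weylRep h xp xm π a (weylMk h xp xm π 1) = weylMk h xp xm π a := by
  change a • weylMk h xp xm π 1 = _
  rw [← map_smul, smul_eq_mul, mul_one]

lemma weylMk_smul (c : ℂ) (a : ULoop 𝔤) : weylMk h xp xm π (c • a) = c • weylMk h xp xm π a := by
  rw [Algebra.smul_def, ← smul_eq_mul, map_smul, algebraMap_smul]

lemma isWeylVector_weylMk_one (hπ : ∀ i, (π i).coeff 0 = 1) :
    IsWeylVector h xp xm (weylRep h xp xm π) (weylMk h xp xm π 1) π := by
  have hP : ∀ i k, weylRep h xp xm π (PowerSeries.coeff k (lambdaPlus (h i)))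
      (weylMk h xp xm π 1) = (π i).coeff k • weylMk h xp xm π 1 := by
    intro i k
    have := weylMk_idealPi h xp xm π (Submodule.subset_span (Or.inl ⟨i, k, rfl⟩))
    rw [map_sub, sub_eq_zero, Algebra.algebraMap_eq_smul_one, weylMk_smul] at this
    rw [weylRep_mk_one, this]
  have hM : ∀ i k, weylRep h xp xm π (PowerSeries.coeff k (lambdaMinus (h i)))
      (weylMk h xp xm π 1) = (polyMinus (π i)).coeff k • weylMk h xp xm π 1 := by
    intro i k
    have := weylMk_idealPi h xp xm π (Submodule.subset_span (Or.inr ⟨i, k, rfl⟩))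
    rw [map_sub, sub_eq_zero, Algebra.algebraMap_eq_smul_one, weylMk_smul] at this
    rw [weylRep_mk_one, this]
  refine ⟨fun i m => ?_, fun i m => ?_, fun i m => ?_, fun i r m hm => ?_⟩
  · rw [weylRep_mk_one]
    exact weylMk_globalRelations h xp xm π (Or.inl <| Or.inl <| Or.inl <| Or.inl <| Or.inl ⟨i, m, rfl⟩)
  · rcases lt_trichotomy m 0 with h0 | rfl | h0
    · obtain ⟨k, hk⟩ := Int.eq_ofNat_of_zero_le (by omega : 0 ≤ -m - 1)
      obtain rfl : m = -((k + 1 : ℕ) : ℤ) := by push_cast; omega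
      exact (lambdaMinus_eigenvector_iff _ _ (h i) (hπ i)).mp (hM i) k
    · have := weylMk_globalRelations h xp xm π
        (Or.inl <| Or.inl <| Or.inl <| Or.inl <| Or.inr ⟨i, rfl⟩)
      rw [map_sub, sub_eq_zero, Algebra.algebraMap_eq_smul_one, weylMk_smul] at this
      rw [weylRep_mk_one, this, powerSum_zero]
    · obtain ⟨k, hk⟩ := Int.eq_ofNat_of_zero_le (by omega : 0 ≤ m - 1)
      obtain rfl : m = ((k + 1 : ℕ) : ℤ) := by push_cast; omega
      exact (lambdaPlus_eigenvector_iff _ _ (h i) (hπ i)).mp (hP i) k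
  · have := weylMk_globalRelations h xp xm π
      (Or.inl <| Or.inr ⟨i, m, 1, one_mem _, rfl⟩)
    rw [mul_one, ← weylRep_mk_one, map_sum, LinearMap.sum_apply] at this
    rw [← this]
    refine sum_congr rfl fun k _ => ?_
    rw [map_mul, Module.End.mul_apply, lam, if_pos (Int.natCast_nonneg k), Int.natAbs_natCast, hP,
      map_smul]
  -- For `r = 0` there is no defining relation to quote; the sum reduces to the coefficient of `u^m`
  -- in `π_i`, and `m` exceeds the degree.
  · rcases Nat.eq_zero_or_pos r with rfl | hr
    · rw [Finset.sum_eq_single (0, m)]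
      · rw [Polynomial.coeff_eq_zero_of_natDegree_lt hm, zero_smul]
      · rintro ⟨a, b⟩ hab hne
        rw [pow_zero, PowerSeries.coeff_one, if_neg, map_zero, LinearMap.zero_apply, smul_zero]
        rintro rfl
        rw [HasAntidiagonal.mem_antidiagonal, zero_add] at hab
        exact hne (by rw [← hab])
      · simp
    · have := weylMk_globalRelations h xp xm π (Or.inr ⟨i, r, m, hr, hm, 1, one_mem _, rfl⟩)
      rw [mul_one, ← weylRep_mk_one, PowerSeries.coeff_mul, map_sum, LinearMap.sum_apply] at this
      rw [← this]
      refine sum_congr rfl fun k _ => ?_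
      rw [map_mul, Module.End.mul_apply, hP, map_smul]

end WeylVector

/-! ### Partial fractions for power series with coprime denominators -/

section SeriesOfBoundedDegree

open Polynomial

variable {S : Type*} [CommRing S]

lemma coeff_eq_zero_of_eq_coe {F : PowerSeries S} {f : S[X]} {n : ℕ} (hF : F = f)
    (hf : f.natDegree ≤ n) (m : ℕ) (hm : n < m) : PowerSeries.coeff m F = 0 := by
  rw [hF, coeff_coe, coeff_eq_zero_of_natDegree_lt (hf.trans_lt hm)]

lemma exists_eq_coe_of_coeff_eq_zero {F : PowerSeries S} {n : ℕ}
    (hF : ∀ m, n < m → PowerSeries.coeff m F = 0) : ∃ f : S[X], F = f ∧ f.natDegree ≤ n := by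
  refine ⟨PowerSeries.trunc (n + 1) F, ?_, ?_⟩
  · ext m
    rw [coeff_coe, PowerSeries.coeff_trunc]
    split_ifs with hm
    · rfl
    · exact hF m (by omega)
  · have := PowerSeries.natDegree_trunc_lt F n
    omega

/-- If `F q + G p`, `F p^r` and `G q^r` are polynomials, with `p` and `q` coprime, then `F` is a
polynomial of the expected degree. -/
lemma coeff_eq_zero_of_coprime [Algebra ℂ S] {p q : ℂ[X]} (hpq : IsCoprime p q) (hp : p ≠ 0)
    {F G : PowerSeries S} {r : ℕ} {f₁ f₂ f₃ : S[X]}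
    (h₁ : F * (q.map (algebraMap ℂ S) : S[X]) + G * (p.map (algebraMap ℂ S) : S[X]) = f₁)
    (h₂ : F * ((p.map (algebraMap ℂ S) : S[X]) : PowerSeries S) ^ r = f₂)
    (h₃ : G * ((q.map (algebraMap ℂ S) : S[X]) : PowerSeries S) ^ r = f₃)
    (hdeg : f₂.natDegree ≤ (r + 1) * p.natDegree) (m : ℕ) (hm : p.natDegree < m) :
    PowerSeries.coeff m F = 0 := by
  nontriviality S
  set P : S[X] := p.map (algebraMap ℂ S)
  set Q : S[X] := q.map (algebraMap ℂ S)
  obtain ⟨α, β, hαβ⟩ : IsCoprime (Q ^ (r + 1)) (P ^ r) :=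
    (hpq.symm.map (mapRingHom (algebraMap ℂ S))).pow
  -- Multiplying the first relation by `Q^r` shows that `F Q^(r+1) = f₁ Q^r - f₃ P` is a polynomial,
  -- and so is `F P^r = f₂`; the Bézout identity recovers `F`. Its degree is then read off from `F
  -- P^r`, the leading coefficient of `P` being a unit even though `S` may have zero divisors.
  have hF : F = ((α * (f₁ * Q ^ r - f₃ * P) + β * f₂ : S[X]) : PowerSeries S) := by
    have h := congrArg (fun x : S[X] => (x : PowerSeries S)) hαβ
    simp only [coe_add, coe_mul, coe_pow, coe_one, coe_sub] at h ⊢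
    rw [← h₁, ← h₂, ← h₃]
    linear_combination (-F) * h
  generalize (α * (f₁ * Q ^ r - f₃ * P) + β * f₂ : S[X]) = f at hF
  refine coeff_eq_zero_of_eq_coe hF ?_ m hm
  rcases eq_or_ne f 0 with rfl | hf
  · simp
  have hPdeg : P.natDegree = p.natDegree := natDegree_map _
  have hlc : P.leadingCoeff = algebraMap ℂ S p.leadingCoeff := leadingCoeff_map _
  have hu : IsUnit P.leadingCoeff := by
    rw [hlc]; exact (isUnit_iff_ne_zero.mpr (leadingCoeff_ne_zero.mpr hp)).map _
  have hpow : (P ^ r).natDegree = r * P.natDegree ∧ (P ^ r).leadingCoeff = P.leadingCoeff ^ r := by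
    have hne : P.leadingCoeff ^ r ≠ 0 := (hu.pow r).ne_zero
    exact ⟨natDegree_pow' hne, leadingCoeff_pow' hne⟩
  have hmul : f * P ^ r = f₂ := by
    rw [hF] at h₂
    exact_mod_cast h₂
  have hne : f.leadingCoeff * (P ^ r).leadingCoeff ≠ 0 := by
    rw [hpow.2]
    intro h0
    rw [(hu.pow r).mul_left_eq_zero] at h0
    exact hf (leadingCoeff_eq_zero.mp h0)
  have := natDegree_mul' hne
  rw [hmul, hpow.1, hPdeg] at this
  rw [this, add_mul, one_mul, add_comm] at hdeg
  omega

/-- If the powers of `Y + Z` have poles bounded by the zeros of `p q`, where `Y p` and `Z q` are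
polynomials and `p`, `q` are coprime, then the powers of `Y` have poles bounded by the zeros of
`p`. -/
lemma coeff_pow_mul_eq_zero [Algebra ℂ S] {p q : ℂ[X]} (hpq : IsCoprime p q) (hp : p ≠ 0)
    (hq : q ≠ 0) {Y Z : PowerSeries S}
    (hY : ∀ m, p.natDegree < m →
      PowerSeries.coeff m (Y * ((p.map (algebraMap ℂ S) : S[X]) : PowerSeries S)) = 0)
    (hZ : ∀ m, q.natDegree < m →
      PowerSeries.coeff m (Z * ((q.map (algebraMap ℂ S) : S[X]) : PowerSeries S)) = 0)
    (hYZ : ∀ r m, p.natDegree + q.natDegree < m →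
      PowerSeries.coeff m ((Y + Z) ^ r * (((p * q).map (algebraMap ℂ S) : S[X]) : PowerSeries S)) = 0) (r : ℕ) :
    (∀ m, p.natDegree < m →
      PowerSeries.coeff m (Y ^ r * ((p.map (algebraMap ℂ S) : S[X]) : PowerSeries S)) = 0) ∧
    ∀ m, q.natDegree < m →
      PowerSeries.coeff m (Z ^ r * ((q.map (algebraMap ℂ S) : S[X]) : PowerSeries S)) = 0 := by
  set P : S[X] := p.map (algebraMap ℂ S) with hP
  set Q : S[X] := q.map (algebraMap ℂ S) with hQ
  induction r using Nat.strong_induction_on with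
  | _ r ih =>
    rcases r with _ | r
    · simp only [pow_zero, one_mul]
      exact ⟨coeff_eq_zero_of_eq_coe rfl natDegree_map_le,
        coeff_eq_zero_of_eq_coe rfl natDegree_map_le⟩
    obtain ⟨y, hy, hydeg⟩ := exists_eq_coe_of_coeff_eq_zero hY
    obtain ⟨z, hz, hzdeg⟩ := exists_eq_coe_of_coeff_eq_zero hZ
    obtain ⟨x, hx, -⟩ := exists_eq_coe_of_coeff_eq_zero (hYZ (r + 1))
    have hyr : Y ^ (r + 1) * P * (P : PowerSeries S) ^ r = ((y ^ (r + 1) : S[X]) : PowerSeries S) := by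
      rw [coe_pow, ← hy]; ring
    have hzr : Z ^ (r + 1) * Q * (Q : PowerSeries S) ^ r = ((z ^ (r + 1) : S[X]) : PowerSeries S) := by
      rw [coe_pow, ← hz]; ring
    -- The mixed terms of `(Y + Z)^(r+1) P Q` involve only powers of `Y` and `Z` with exponents from
    -- `1` to `r`, which the induction hypothesis covers.
    have hmid : ∃ g : S[X], (∑ k ∈ Finset.range r, Y ^ (k + 1) * Z ^ (r - k) *
        ((r + 1).choose (k + 1) : PowerSeries S)) * P * Q = g := by
      have : ∀ k ∈ Finset.range r, ∃ g : S[X], Y ^ (k + 1) * Z ^ (r - k) *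
          ((r + 1).choose (k + 1) : PowerSeries S) * P * Q = g := by
        intro k hk
        rw [Finset.mem_range] at hk
        obtain ⟨a, ha, -⟩ := exists_eq_coe_of_coeff_eq_zero (ih (k + 1) (by omega)).1
        obtain ⟨b, hb, -⟩ := exists_eq_coe_of_coeff_eq_zero (ih (r - k) (by omega)).2
        refine ⟨a * b * ((r + 1).choose (k + 1) : S[X]), ?_⟩
        have hc : ((((r + 1).choose (k + 1) : ℕ) : S[X]) : PowerSeries S) =
            ((r + 1).choose (k + 1) : PowerSeries S) := map_natCast (coeToPowerSeries.ringHom) _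
        rw [coe_mul, coe_mul, ← ha, ← hb, hc]
        ring
      choose! g hg using this
      refine ⟨∑ k ∈ Finset.range r, g k, ?_⟩
      rw [Finset.sum_mul, Finset.sum_mul, Finset.sum_congr rfl hg]
      exact (map_sum (coeToPowerSeries.ringHom) _ _).symm
    obtain ⟨g, hg⟩ := hmid
    have hsum : Y ^ (r + 1) * P * (Q : PowerSeries S) + Z ^ (r + 1) * Q * (P : PowerSeries S) =
        ((x - g : S[X]) : PowerSeries S) := by
      rw [coe_sub, ← hx, ← hg, Polynomial.map_mul, coe_mul, ← hP, ← hQ, add_pow,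
        Finset.sum_range_succ, Finset.sum_range_succ']
      simp only [Nat.choose_self, Nat.choose_zero_right, Nat.sub_self, pow_zero,
        Nat.add_sub_add_right, Nat.sub_zero, Nat.cast_one]
      ring
    have deg : ∀ {f : S[X]} {n : ℕ}, f.natDegree ≤ n → (f ^ (r + 1)).natDegree ≤ (r + 1) * n :=
      fun hf => natDegree_pow_le.trans (Nat.mul_le_mul_left _ hf)
    -- Applied with `F = Y^(r+1) P` and `G = Z^(r+1) Q`; here `F P^r = (Y P)^(r+1)` has degree at
    -- most `(r+1) deg p`.
    exact ⟨coeff_eq_zero_of_coprime hpq hp hsum hyr hzr (deg hydeg),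
      coeff_eq_zero_of_coprime hpq.symm hq (by rw [add_comm]; exact hsum) hzr hyr (deg hzdeg)⟩

end SeriesOfBoundedDegree

/-! ### Tensor products of Weyl vectors -/

section TensorVector

open Finset

attribute [local instance] LieRing.ofAssociativeRing

variable {𝔤 : Type*} [LieRing 𝔤] [LieAlgebra ℂ 𝔤] {I : Type*}

/-- The element `x ⊗ f` of `L(𝔤)`, viewed in `U`. -/
def loopGen (x : 𝔤) (f : LaurentPolynomial ℂ) : ULoop 𝔤 :=
  UniversalEnvelopingAlgebra.ι ℂ (f ⊗ₜ[ℂ] x : Loop 𝔤)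

lemma gen_eq_loopGen (x : 𝔤) (m : ℤ) : gen x m = loopGen x (LaurentPolynomial.T m) := rfl

lemma loopGen_add (x : 𝔤) (f g : LaurentPolynomial ℂ) :
    loopGen x (f + g) = loopGen x f + loopGen x g := by
  rw [loopGen, TensorProduct.add_tmul, map_add]; rfl

lemma loopGen_smul (x : 𝔤) (c : ℂ) (f : LaurentPolynomial ℂ) :
    loopGen x (c • f) = c • loopGen x f := by
  rw [loopGen, ← TensorProduct.smul_tmul', map_smul]; rfl

lemma loopGen_lie (x y : 𝔤) (f g : LaurentPolynomial ℂ) :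
    loopGen ⁅x, y⁆ (f * g) = loopGen x f * loopGen y g - loopGen y g * loopGen x f := by
  rw [loopGen, ← LieAlgebra.ExtendScalars.bracket_tmul, LieHom.map_lie,
    LieRing.of_associative_ring_bracket]
  rfl

/-- `p(t⁻¹)` as a Laurent polynomial. -/
def invEval (p : ℂ[X]) : LaurentPolynomial ℂ := Polynomial.aeval (LaurentPolynomial.T (-1)) p

lemma invEval_mul (p q : ℂ[X]) : invEval (p * q) = invEval p * invEval q := map_mul _ p q

variable {M : Type*} [AddCommGroup M] [Module ℂ M]

/-- The map `f ↦ (x ⊗ f) w`. -/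
def loopGenApply (ρ : ULoop 𝔤 →ₐ[ℂ] Module.End ℂ M) (x : 𝔤) (w : M) :
    LaurentPolynomial ℂ →ₗ[ℂ] M where
  toFun f := ρ (loopGen x f) w
  map_add' f g := by rw [loopGen_add, map_add, LinearMap.add_apply]
  map_smul' c f := by rw [loopGen_smul, map_smul, LinearMap.smul_apply, RingHom.id_apply]

lemma loopGenApply_apply (ρ : ULoop 𝔤 →ₐ[ℂ] Module.End ℂ M) (x : 𝔤) (w : M)
    (f : LaurentPolynomial ℂ) : loopGenApply ρ x w f = ρ (loopGen x f) w := rfl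

lemma T_mul_invEval (p : ℂ[X]) (m : ℤ) : LaurentPolynomial.T m * invEval p =
    ∑ k ∈ range (p.natDegree + 1), p.coeff k • LaurentPolynomial.T (m - k) := by
  rw [invEval, Polynomial.aeval_eq_sum_range, mul_sum]
  refine sum_congr rfl fun k _ => ?_
  rw [mul_smul_comm, LaurentPolynomial.T_pow, ← LaurentPolynomial.T_add]
  congr 2
  ring

lemma sum_lowering_eq (ρ : ULoop 𝔤 →ₐ[ℂ] Module.End ℂ M) (x : 𝔤) (w : M) (p : ℂ[X]) (m : ℤ) :
    ∑ k ∈ range (p.natDegree + 1), p.coeff k • ρ (gen x (m - k)) w =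
      ρ (loopGen x (LaurentPolynomial.T m * invEval p)) w := by
  rw [← loopGenApply_apply, T_mul_invEval, map_sum]
  simp only [map_smul]
  rfl

lemma laurent_linear_ext {f g : LaurentPolynomial ℂ →ₗ[ℂ] M}
    (hfg : ∀ m : ℤ, f (LaurentPolynomial.T m) = g (LaurentPolynomial.T m)) : f = g := by
  refine LinearMap.ext fun a => ?_
  induction a using LaurentPolynomial.induction_on' with
  | add p q hp hq => rw [map_add, map_add, hp, hq]
  | C_mul_T n a =>
    rw [← LaurentPolynomial.smul_eq_C_mul, map_smul, map_smul, hfg]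

/-- The lowering relations say that `x ⊗ (p(t⁻¹))` kills `w`. -/
lemma lowering_iff (ρ : ULoop 𝔤 →ₐ[ℂ] Module.End ℂ M) (x : 𝔤) (w : M) (p : ℂ[X]) :
    (∀ m : ℤ, ∑ k ∈ range (p.natDegree + 1), p.coeff k • ρ (gen x (m - 1 - k)) w = 0) ↔
      ∀ f, invEval p ∣ f → ρ (loopGen x f) w = 0 := by
  constructor
  · rintro hm _ ⟨f, rfl⟩
    have : loopGenApply ρ x w ∘ₗ LinearMap.mulLeft ℂ (invEval p) = 0 := by
      refine laurent_linear_ext fun m => ?_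
      have h := hm (m + 1)
      rw [add_sub_cancel_right, sum_lowering_eq] at h
      rw [LinearMap.comp_apply, LinearMap.mulLeft_apply, mul_comm]
      exact h
    exact LinearMap.congr_fun this f
  · intro hf m
    rw [sum_lowering_eq]
    exact hf _ (Dvd.intro_left _ rfl)

/-- `p` as a power series over a `ℂ`-algebra. -/
abbrev polySeries (A : Type*) [Ring A] [Algebra ℂ A] (p : ℂ[X]) : PowerSeries A :=
  PowerSeries.map (algebraMap ℂ A) (p : PowerSeries ℂ)

lemma map_polySeries {A B : Type*} [Ring A] [Algebra ℂ A] [Ring B] [Algebra ℂ B]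
    (φ : A →ₐ[ℂ] B) (p : ℂ[X]) :
    PowerSeries.map (φ : A →+* B) (polySeries A p) = polySeries B p := by
  ext m
  simp

lemma polySeries_eq_coe {S : Type*} [CommRing S] [Algebra ℂ S] (p : ℂ[X]) :
    polySeries S p = ((p.map (algebraMap ℂ S) : S[X]) : PowerSeries S) := by
  ext m
  simp

lemma sum_power_eq (ρ : ULoop 𝔤 →ₐ[ℂ] Module.End ℂ M) (x : 𝔤) (w : M) (p : ℂ[X]) (r m : ℕ) :
    ∑ k ∈ antidiagonal m, p.coeff k.2 • ρ (PowerSeries.coeff k.1 (xSeries x ^ r)) w =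
      PowerSeries.coeff m (PowerSeries.map (ρ : ULoop 𝔤 →+* Module.End ℂ M) (xSeries x) ^ r *
        polySeries (Module.End ℂ M) p) w := by
  rw [← map_pow, PowerSeries.coeff_mul, LinearMap.sum_apply]
  refine sum_congr rfl fun k _ => ?_
  rw [PowerSeries.coeff_map, PowerSeries.coeff_map, Module.End.mul_apply, Polynomial.coeff_coe,
    Module.algebraMap_end_apply, map_smul]
  rfl

variable {h xp xm : I → 𝔤}

lemma natDegree_mul_of_coeff_zero {p q : ℂ[X]} (hp : p.coeff 0 = 1) (hq : q.coeff 0 = 1) :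
    (p * q).natDegree = p.natDegree + q.natDegree :=
  Polynomial.natDegree_mul (by rintro rfl; simp at hp) (by rintro rfl; simp at hq)

lemma commute_of_coeff {A : Type*} [Ring A] {F G : PowerSeries A}
    (hFG : ∀ m n, Commute (PowerSeries.coeff m F) (PowerSeries.coeff n G)) : Commute F G := by
  ext m
  rw [PowerSeries.coeff_mul, PowerSeries.coeff_mul, ← Finset.Nat.sum_antidiagonal_swap]
  exact sum_congr rfl fun k _ => hFG _ _

/-- The tensor product of Weyl vectors for `π` and `π'` is a Weyl vector for `π π'`. -/
lemma IsWeylVector.tmul {M' : Type*} [AddCommGroup M'] [Module ℂ M']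
    {ρ : ULoop 𝔤 →ₐ[ℂ] Module.End ℂ M} {ρ' : ULoop 𝔤 →ₐ[ℂ] Module.End ℂ M'}
    {σ : ULoop 𝔤 →ₐ[ℂ] Module.End ℂ (M ⊗[ℂ] M')}
    (hσ : ∀ x f, σ (loopGen x f) = Module.End.rTensorAlgHom ℂ M M' (ρ (loopGen x f)) +
      Module.End.lTensorAlgHom ℂ M' M (ρ' (loopGen x f)))
    {w : M} {w' : M'} {π π' : I → ℂ[X]} (hπ : ∀ i, (π i).coeff 0 = 1)
    (hπ' : ∀ i, (π' i).coeff 0 = 1) (H : IsWeylVector h xp xm ρ w π)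
    (H' : IsWeylVector h xp xm ρ' w' π') :
    IsWeylVector h xp xm σ (w ⊗ₜ w') (fun i => π i * π' i) := by
  have hσ' : ∀ x f, σ (loopGen x f) (w ⊗ₜ w') =
      ρ (loopGen x f) w ⊗ₜ w' + w ⊗ₜ ρ' (loopGen x f) w' := by
    intro x f
    rw [hσ, LinearMap.add_apply]
    rfl
  have hne : ∀ i, π i * π' i ≠ 0 := fun i h0 => by
    have := Polynomial.mul_coeff_zero (π i) (π' i)
    rw [h0, hπ, hπ'] at this
    simp at this
  refine ⟨fun i m => ?_, fun i m => ?_, fun i => ?_, fun i r m hm => ?_⟩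
  · rw [gen_eq_loopGen, hσ', ← gen_eq_loopGen, H.raising, H'.raising,
      TensorProduct.zero_tmul, TensorProduct.tmul_zero, add_zero]
  · rw [gen_eq_loopGen, hσ', ← gen_eq_loopGen, H.cartan, H'.cartan,
      powerSum_mul (hne i), add_smul, TensorProduct.smul_tmul', TensorProduct.tmul_smul]
  · refine (lowering_iff σ (xm i) _ _).mpr fun f hf => ?_
    rw [invEval_mul] at hf
    rw [hσ', (lowering_iff ρ (xm i) w _).mp (H.lowering i) f (dvd_of_mul_right_dvd hf),
      (lowering_iff ρ' (xm i) w' _).mp (H'.lowering i) f (dvd_of_mul_left_dvd hf),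
      TensorProduct.zero_tmul, TensorProduct.tmul_zero, add_zero]
  · rw [natDegree_mul_of_coeff_zero (hπ i) (hπ' i)] at hm
    rw [sum_power_eq]
    set L := Module.End.rTensorAlgHom ℂ M M'
    set R := Module.End.lTensorAlgHom ℂ M' M
    set X := PowerSeries.map (ρ : ULoop 𝔤 →+* Module.End ℂ M) (xSeries (xm i))
    set X' := PowerSeries.map (ρ' : ULoop 𝔤 →+* Module.End ℂ M') (xSeries (xm i))
    have hsum : PowerSeries.map (σ : ULoop 𝔤 →+* Module.End ℂ (M ⊗[ℂ] M')) (xSeries (xm i)) =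
        PowerSeries.map (L : Module.End ℂ M →+* Module.End ℂ (M ⊗[ℂ] M')) X +
          PowerSeries.map (R : Module.End ℂ M' →+* Module.End ℂ (M ⊗[ℂ] M')) X' := by
      ext1 k
      simp only [X, X', map_add, PowerSeries.coeff_map, xSeries, PowerSeries.coeff_mk]
      split_ifs
      · simp
      · exact hσ _ _
    have hcomm : ∀ (a : Module.End ℂ M) (b : Module.End ℂ M'), Commute (L a) (R b) := by
      intro a b
      refine TensorProduct.ext' fun u v => ?_
      rfl
    have hLR : ∀ F G, Commute (PowerSeries.map (L : Module.End ℂ M →+* Module.End ℂ (M ⊗[ℂ] M')) F)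
        (PowerSeries.map (R : Module.End ℂ M' →+* Module.End ℂ (M ⊗[ℂ] M')) G) := by
      intro F G
      refine commute_of_coeff fun m n => ?_
      rw [PowerSeries.coeff_map, PowerSeries.coeff_map]
      exact hcomm _ _
    have hpoly : polySeries (Module.End ℂ (M ⊗[ℂ] M')) (π i * π' i) =
        PowerSeries.map (L : Module.End ℂ M →+* Module.End ℂ (M ⊗[ℂ] M')) (polySeries _ (π i)) *
          PowerSeries.map (R : Module.End ℂ M' →+* Module.End ℂ (M ⊗[ℂ] M')) (polySeries _ (π' i)) := by
      rw [map_polySeries, map_polySeries, polySeries, Polynomial.coe_mul, map_mul]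
    -- The two summands of the coproduct commute, so each binomial term times ππ' splits as `(X^k
    -- π)(X'^l π')`.
    rw [hsum, (hLR X X').add_pow', hpoly, sum_mul, map_sum, LinearMap.sum_apply]
    refine sum_eq_zero fun k _ => ?_
    rw [smul_mul_assoc, map_nsmul, ((hLR (polySeries _ (π i)) X').symm.pow_left k.2).mul_mul_mul_comm,
      ← map_pow (PowerSeries.map (L : Module.End ℂ M →+* Module.End ℂ (M ⊗[ℂ] M'))) X,
      ← map_pow (PowerSeries.map (R : Module.End ℂ M' →+* Module.End ℂ (M ⊗[ℂ] M'))) X',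
      ← map_mul, ← map_mul, PowerSeries.coeff_mul, LinearMap.smul_apply, LinearMap.sum_apply]
    refine (congrArg _ (sum_eq_zero fun j hj => ?_)).trans (smul_zero _)
    rw [PowerSeries.coeff_map, PowerSeries.coeff_map]
    change (PowerSeries.coeff j.1 (X ^ k.1 * polySeries (Module.End ℂ M) (π i))) w ⊗ₜ
      (PowerSeries.coeff j.2 (X' ^ k.2 * polySeries (Module.End ℂ M') (π' i))) w' = 0
    rw [HasAntidiagonal.mem_antidiagonal] at hj
    -- The two degrees add up to more than `deg π_i + deg π'_i`, so one of the two factors exceeds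
    -- its own bound.
    rcases lt_or_ge (π i).natDegree j.1 with hlt | hge
    · rw [← sum_power_eq, H.power i k.1 j.1 hlt, TensorProduct.zero_tmul]
    · rw [← sum_power_eq ρ', H'.power i k.2 j.2 (by omega), TensorProduct.tmul_zero]

end TensorVector

/-! ### Annihilators of cyclic modules and twisted actions -/

section Annihilation

attribute [local instance] LieRing.ofAssociativeRing

variable {𝔤 : Type*} [LieRing 𝔤] [LieAlgebra ℂ 𝔤] {I : Type*}

/-- A subalgebra of the enveloping algebra containing the Lie algebra is everything. -/
lemma uLoop_subalgebra_eq_top {S : Subalgebra ℂ (ULoop 𝔤)}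
    (hS : ∀ x f, loopGen x f ∈ S) : S = ⊤ := by
  have hι : ∀ X : Loop 𝔤, UniversalEnvelopingAlgebra.ι ℂ X ∈ S := by
    intro X
    induction X using TensorProduct.induction_on with
    | zero => rw [map_zero]; exact S.zero_mem
    | tmul f x => exact hS x f
    | add X Y hX hY => rw [map_add]; exact S.add_mem hX hY
  let F : Loop 𝔤 →ₗ⁅ℂ⁆ S :=
    { toFun := fun X => ⟨UniversalEnvelopingAlgebra.ι ℂ X, hι X⟩
      map_add' := fun X Y => Subtype.ext (map_add _ X Y)
      map_smul' := fun c X => Subtype.ext (map_smul _ c X)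
      map_lie' := fun {X Y} => Subtype.ext (LieHom.map_lie _ X Y) }
  -- The inclusion of the Lie algebra into `S` extends to an algebra map `U → S`, which is a section
  -- of the inclusion of `S`.
  have hid : S.val.comp (UniversalEnvelopingAlgebra.lift ℂ F) = AlgHom.id ℂ (ULoop 𝔤) := by
    refine UniversalEnvelopingAlgebra.hom_ext ℂ (LieHom.ext fun X => ?_)
    change ((UniversalEnvelopingAlgebra.lift ℂ F (UniversalEnvelopingAlgebra.ι ℂ X) : S) : ULoop 𝔤)
      = UniversalEnvelopingAlgebra.ι ℂ X
    rw [UniversalEnvelopingAlgebra.lift_ι_apply]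
    rfl
  refine eq_top_iff.mpr fun a _ => ?_
  have := AlgHom.congr_fun hid a
  rw [← AlgHom.id_apply (R := ℂ) a, ← this]
  exact (UniversalEnvelopingAlgebra.lift ℂ F a).2

lemma loopGen_induction {p : ULoop 𝔤 → Prop} (hgen : ∀ x f, p (loopGen x f))
    (halg : ∀ c, p (algebraMap ℂ _ c)) (hadd : ∀ a b, p a → p b → p (a + b))
    (hmul : ∀ a b, p a → p b → p (a * b)) (a : ULoop 𝔤) : p a := by
  let S : Subalgebra ℂ (ULoop 𝔤) :=
    { carrier := {a | p a}
      add_mem' := fun ha hb => hadd _ _ ha hb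
      mul_mem' := fun ha hb => hmul _ _ ha hb
      algebraMap_mem' := halg }
  have : a ∈ S := by
    rw [uLoop_subalgebra_eq_top (S := S) hgen]
    trivial
  exact this

variable {M : Type*} [AddCommGroup M] [Module ℂ M] {h xp xm : I → 𝔤}

/-- The elements `x` such that `x ⊗ (P)` kills `w`. -/
def loopKer (ρ : ULoop 𝔤 →ₐ[ℂ] Module.End ℂ M) (w : M) (P : LaurentPolynomial ℂ) :
    Submodule ℂ 𝔤 where
  carrier := {x | ∀ f, P ∣ f → ρ (loopGen x f) w = 0}
  zero_mem' := fun f _ => by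
    rw [loopGen, TensorProduct.tmul_zero, map_zero, map_zero, LinearMap.zero_apply]
  add_mem' := fun {x y} hx hy f hf => by
    have : loopGen (x + y) f = loopGen x f + loopGen y f := by
      rw [loopGen, TensorProduct.tmul_add, map_add]; rfl
    rw [this, map_add, LinearMap.add_apply, hx f hf, hy f hf, add_zero]
  smul_mem' := fun c x hx f hf => by
    have : loopGen (c • x) f = c • loopGen x f := by
      rw [loopGen, TensorProduct.tmul_smul, map_smul]; rfl
    rw [this, map_smul, LinearMap.smul_apply, hx f hf, smul_zero]

lemma mem_loopKer {ρ : ULoop 𝔤 →ₐ[ℂ] Module.End ℂ M} {w : M} {P : LaurentPolynomial ℂ} {x : 𝔤} :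
    x ∈ loopKer ρ w P ↔ ∀ f, P ∣ f → ρ (loopGen x f) w = 0 := Iff.rfl

lemma loopKer_mono {ρ : ULoop 𝔤 →ₐ[ℂ] Module.End ℂ M} {w : M} {P Q : LaurentPolynomial ℂ}
    (hPQ : P ∣ Q) : loopKer ρ w P ≤ loopKer ρ w Q :=
  fun _ hx f hf => hx f (hPQ.trans hf)

/-- The element `⁅x, y⁆ ⊗ PQf` is the commutator of `x ⊗ P` and `y ⊗ Qf`, both of which kill `w`.
This is why powers of one `P` lead to a Lie subalgebra. -/
lemma lie_mem_loopKer {ρ : ULoop 𝔤 →ₐ[ℂ] Module.End ℂ M} {w : M} {P Q : LaurentPolynomial ℂ}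
    {x y : 𝔤} (hx : x ∈ loopKer ρ w P) (hy : y ∈ loopKer ρ w Q) : ⁅x, y⁆ ∈ loopKer ρ w (P * Q) := by
  rw [mem_loopKer] at *
  rintro _ ⟨f, rfl⟩
  rw [mul_assoc, loopGen_lie, map_sub, map_mul, map_mul, LinearMap.sub_apply,
    Module.End.mul_apply, Module.End.mul_apply, hy _ (dvd_mul_right _ _),
    hx _ (dvd_refl _), map_zero, map_zero, sub_zero]

/-- The elements `x` such that `x ⊗ (P ^ N)` kills `w` for some `N`. -/
def loopKerPow (ρ : ULoop 𝔤 →ₐ[ℂ] Module.End ℂ M) (w : M) (P : LaurentPolynomial ℂ) :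
    LieSubalgebra ℂ 𝔤 where
  carrier := {x | ∃ N : ℕ, x ∈ loopKer ρ w (P ^ N)}
  zero_mem' := ⟨0, zero_mem _⟩
  add_mem' := by
    rintro x y ⟨N, hx⟩ ⟨N', hy⟩
    exact ⟨N + N', add_mem (loopKer_mono (pow_dvd_pow P (Nat.le_add_right _ _)) hx)
      (loopKer_mono (pow_dvd_pow P (Nat.le_add_left _ _)) hy)⟩
  smul_mem' := by
    rintro c x ⟨N, hx⟩
    exact ⟨N, Submodule.smul_mem _ c hx⟩
  lie_mem' := by
    rintro x y ⟨N, hx⟩ ⟨N', hy⟩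
    exact ⟨N + N', by rw [pow_add]; exact lie_mem_loopKer hx hy⟩

lemma mem_loopKerPow {ρ : ULoop 𝔤 →ₐ[ℂ] Module.End ℂ M} {w : M} {P : LaurentPolynomial ℂ}
    {x : 𝔤} : x ∈ loopKerPow ρ w P ↔ ∃ N : ℕ, x ∈ loopKer ρ w (P ^ N) := Iff.rfl

/-- The vectors killed by `𝔤 ⊗ (P)` form a `U`-submodule. -/
lemma loopGen_apply_apply_eq_zero (ρ : ULoop 𝔤 →ₐ[ℂ] Module.End ℂ M) {P : LaurentPolynomial ℂ}
    (a : ULoop 𝔤) : ∀ u : M, (∀ x f, P ∣ f → ρ (loopGen x f) u = 0) →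
      ∀ x f, P ∣ f → ρ (loopGen x f) (ρ a u) = 0 := by
  induction a using loopGen_induction with
  | hgen y g =>
    intro u hu x f hf
    have h1 : loopGen x f * loopGen y g = loopGen ⁅x, y⁆ (f * g) + loopGen y g * loopGen x f := by
      rw [loopGen_lie, sub_add_cancel]
    rw [← Module.End.mul_apply, ← map_mul, h1, map_add, LinearMap.add_apply,
      hu _ _ (hf.mul_right g), map_mul, Module.End.mul_apply, hu x f hf, map_zero, zero_add]
  | halg c =>
    intro u hu x f hf
    rw [AlgHom.commutes, Module.algebraMap_end_apply, map_smul, hu x f hf, smul_zero]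
  | hadd a b iha ihb =>
    intro u hu x f hf
    rw [map_add, LinearMap.add_apply, map_add, iha u hu x f hf, ihb u hu x f hf, add_zero]
  | hmul a b iha ihb =>
    intro u hu x f hf
    rw [map_mul, Module.End.mul_apply]
    exact iha _ (ihb u hu) x f hf

/-- A cyclic module over `U` with a Weyl vector is killed by a power of `∏ π_i(t⁻¹)`. -/
lemma IsWeylVector.exists_annihilator [Fintype I] [FiniteDimensional ℂ 𝔤]
    {ρ : ULoop 𝔤 →ₐ[ℂ] Module.End ℂ M} {w : M} {π : I → ℂ[X]} (H : IsWeylVector h xp xm ρ w π)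
    (hcyc : ∀ z, ∃ a, ρ a w = z)
    (hgen : ∀ S : LieSubalgebra ℂ 𝔤, (∀ i, xp i ∈ S) → (∀ i, xm i ∈ S) → S = ⊤) :
    ∃ N : ℕ, ∀ x f z, (∏ i, invEval (π i)) ^ N ∣ f → ρ (loopGen x f) z = 0 := by
  -- The subalgebra contains `x_i⁺` with exponent `0` and `x_i⁻` with exponent `1`.
  have hS : loopKerPow ρ w (∏ i, invEval (π i)) = ⊤ := by
    refine hgen _ (fun i => mem_loopKerPow.mpr ⟨0, mem_loopKer.mpr fun f _ => ?_⟩)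
      fun i => mem_loopKerPow.mpr ⟨1, mem_loopKer.mpr fun f hf => ?_⟩
    · have : loopGenApply ρ (xp i) w = 0 := laurent_linear_ext fun m => H.raising i m
      exact LinearMap.congr_fun this f
    · rw [pow_one] at hf
      exact (lowering_iff ρ (xm i) w _).mp (H.lowering i) f
        ((Finset.dvd_prod_of_mem (fun i => invEval (π i)) (Finset.mem_univ i)).trans hf)
  have hex : ∀ x, ∃ N : ℕ, x ∈ loopKer ρ w ((∏ i, invEval (π i)) ^ N) := fun x => by
    rw [← mem_loopKerPow, hS]
    exact LieSubalgebra.mem_top x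
  -- The exponent depends on `x`; a finite basis of `𝔤` makes it uniform.
  choose N hN using fun j => hex (Module.finBasis ℂ 𝔤 j)
  have htop : loopKer ρ w ((∏ i, invEval (π i)) ^ Finset.univ.sup N) = ⊤ := by
    rw [eq_top_iff, ← (Module.finBasis ℂ 𝔤).span_eq, Submodule.span_le]
    rintro _ ⟨j, rfl⟩
    exact loopKer_mono (pow_dvd_pow _ (Finset.le_sup (Finset.mem_univ j))) (hN j)
  refine ⟨Finset.univ.sup N, fun x f z hf => ?_⟩
  obtain ⟨a, rfl⟩ := hcyc z
  refine loopGen_apply_apply_eq_zero ρ a w (fun x f hf => ?_) x f hf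
  have hx : x ∈ loopKer ρ w ((∏ i, invEval (π i)) ^ Finset.univ.sup N) := by
    rw [htop]; exact Submodule.mem_top
  exact mem_loopKer.mp hx f hf

/-- If `e` acts as an idempotent, `x ⊗ f ↦ x ⊗ e f` defines a representation. -/
lemma exists_twist (ρ : ULoop 𝔤 →ₐ[ℂ] Module.End ℂ M) (e : LaurentPolynomial ℂ)
    (he : ∀ x f, ρ (loopGen x (e * e * f)) = ρ (loopGen x (e * f))) :
    ∃ σ : ULoop 𝔤 →ₐ[ℂ] Module.End ℂ M, ∀ x f, σ (loopGen x f) = ρ (loopGen x (e * f)) := by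
  let F : Loop 𝔤 →ₗ[ℂ] Module.End ℂ M :=
    ρ.toLinearMap ∘ₗ (UniversalEnvelopingAlgebra.ι ℂ : Loop 𝔤 →ₗ⁅ℂ⁆ ULoop 𝔤).toLinearMap ∘ₗ
      TensorProduct.map (LinearMap.mulLeft ℂ e) LinearMap.id
  have hF : ∀ x f, F (f ⊗ₜ x) = ρ (loopGen x (e * f)) := fun x f => rfl
  have hlie : ∀ X Y : Loop 𝔤, F ⁅X, Y⁆ = F X * F Y - F Y * F X := by
    intro X Y
    induction X using TensorProduct.induction_on with
    | zero =>
      have h0 : ⁅(0 : Loop 𝔤), Y⁆ = 0 := zero_lie Y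
      rw [h0, map_zero, zero_mul, mul_zero, sub_zero]
    | add X X' hX hX' =>
      have hadd : ⁅X + X', Y⁆ = ⁅X, Y⁆ + ⁅X', Y⁆ := add_lie X X' Y
      rw [hadd, map_add, map_add, hX, hX', add_mul, mul_add]; abel
    | tmul f x =>
      induction Y using TensorProduct.induction_on with
      | zero =>
        have h0 : ⁅(f ⊗ₜ x : Loop 𝔤), (0 : Loop 𝔤)⁆ = 0 := lie_zero (f ⊗ₜ x : Loop 𝔤)
        rw [h0, map_zero, zero_mul, mul_zero, sub_zero]
      | add Y Y' hY hY' =>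
        have hadd : ⁅(f ⊗ₜ x : Loop 𝔤), Y + Y'⁆ = ⁅(f ⊗ₜ x : Loop 𝔤), Y⁆ + ⁅(f ⊗ₜ x : Loop 𝔤), Y'⁆ :=
          lie_add (f ⊗ₜ x : Loop 𝔤) Y Y'
        rw [hadd, map_add, map_add, hY, hY', add_mul, mul_add]; abel
      | tmul g y =>
        -- A commutator of twisted elements carries `e²` where the twist of the bracket carries `e`;
        -- the hypothesis identifies their actions.
        rw [LieAlgebra.ExtendScalars.bracket_tmul, hF, hF, hF, ← he, ← map_mul, ← map_mul,
          ← map_sub, ← loopGen_lie, mul_mul_mul_comm]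
  let F' : Loop 𝔤 →ₗ⁅ℂ⁆ Module.End ℂ M :=
    { F with
      map_lie' := fun {X Y} => (hlie X Y).trans (LieRing.of_associative_ring_bracket _ _).symm }
  exact ⟨UniversalEnvelopingAlgebra.lift ℂ F', fun x f =>
    UniversalEnvelopingAlgebra.lift_ι_apply ℂ F' _⟩

end Annihilation

/-! ### Evaluation of Laurent polynomials at inverse roots -/

section Evaluation

/-- Evaluation of Laurent polynomials at `r⁻¹` (at `1` if `r = 0`). -/
def evalInv (r : ℂ) : LaurentPolynomial ℂ →+* ℂ :=
  LaurentPolynomial.eval₂ (RingHom.id ℂ) (if hr : r = 0 then 1 else (Units.mk0 r hr)⁻¹)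

lemma evalInv_T {r : ℂ} (hr : r ≠ 0) (m : ℤ) : evalInv r (LaurentPolynomial.T m) = r ^ (-m) := by
  rw [evalInv, LaurentPolynomial.eval₂_T, dif_neg hr, inv_zpow', Units.val_zpow_eq_zpow_val,
    Units.val_mk0]

lemma evalInv_smul (r c : ℂ) (f : LaurentPolynomial ℂ) : evalInv r (c • f) = c * evalInv r f := by
  rw [LaurentPolynomial.smul_eq_C_mul, map_mul, evalInv, LaurentPolynomial.eval₂_C,
    RingHom.id_apply]

/-- Evaluation at `r⁻¹` sends `t⁻¹` to `r`, so elements of the ideal `(p(t⁻¹))` vanish at the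
inverses of the roots of `p`. -/
lemma evalInv_invEval {r : ℂ} (hr : r ≠ 0) (p : ℂ[X]) : evalInv r (invEval p) = p.eval r := by
  rw [invEval, Polynomial.aeval_eq_sum_range, map_sum, Polynomial.eval_eq_sum_range]
  refine Finset.sum_congr rfl fun k _ => ?_
  rw [evalInv_smul, map_pow, evalInv_T hr, neg_neg, zpow_one]

lemma evalInv_eq_zero {p : ℂ[X]} (hp : p.coeff 0 = 1) {r : ℂ} (hr : r ∈ p.roots)
    {f : LaurentPolynomial ℂ} (hf : invEval p ∣ f) : evalInv r f = 0 := by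
  obtain ⟨g, rfl⟩ := hf
  rw [map_mul, evalInv_invEval (root_ne_zero hp hr), (Polynomial.mem_roots'.mp hr).2, zero_mul]

/-- The functional `f ↦ ∑ f(r⁻¹)`, where `r` runs over the roots of `p`. -/
def sumEvalInv (p : ℂ[X]) : LaurentPolynomial ℂ →ₗ[ℂ] ℂ where
  toFun f := (p.roots.map fun r => evalInv r f).sum
  map_add' f g := by simp only [map_add, Multiset.sum_map_add]
  map_smul' c f := by
    simp only [evalInv_smul, Multiset.sum_map_mul_left, RingHom.id_apply, smul_eq_mul]

lemma sumEvalInv_T {p : ℂ[X]} (hp : p.coeff 0 = 1) (m : ℤ) :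
    sumEvalInv p (LaurentPolynomial.T m) = powerSum p m :=
  congrArg Multiset.sum (Multiset.map_congr rfl fun _ hr => evalInv_T (root_ne_zero hp hr) m)

/-- If `e` is `1` at the roots of `p` and `0` at those of `q`, multiplication by `e` selects the
contribution of `p`. -/
lemma sumEvalInv_mul {p q : ℂ[X]} (hp : p.coeff 0 = 1) (hq : q.coeff 0 = 1)
    {e e' : LaurentPolynomial ℂ} (he : e + e' = 1) (h : invEval q ∣ e) (h' : invEval p ∣ e')
    (f : LaurentPolynomial ℂ) : sumEvalInv (p * q) (e * f) = sumEvalInv p f := by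
  have hne : p * q ≠ 0 := mul_ne_zero (by rintro rfl; simp at hp) (by rintro rfl; simp at hq)
  change ((p * q).roots.map _).sum = (p.roots.map _).sum
  rw [Polynomial.roots_mul hne, Multiset.map_add, Multiset.sum_add]
  have h1 : ∀ r ∈ p.roots, evalInv r (e * f) = evalInv r f := by
    intro r hr
    rw [map_mul, eq_sub_of_add_eq he, map_sub, evalInv_eq_zero hp hr h', map_one, sub_zero, one_mul]
  have h2 : ∀ r ∈ q.roots, evalInv r (e * f) = 0 := by
    intro r hr
    rw [map_mul, evalInv_eq_zero hq hr h, zero_mul]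
  rw [Multiset.map_congr rfl h1, Multiset.map_congr rfl h2, Multiset.sum_map_zero, add_zero]

end Evaluation

/-! ### Weyl vectors for the twisted actions -/

section Twist

open Finset

attribute [local instance] LieRing.ofAssociativeRing

variable {𝔤 : Type*} [LieRing 𝔤] [LieAlgebra ℂ 𝔤] {I : Type*}
variable {M : Type*} [AddCommGroup M] [Module ℂ M] {h xp xm : I → 𝔤}

lemma coeff_succ_xSeries (x : 𝔤) (k : ℕ) : PowerSeries.coeff (k + 1) (xSeries x) = gen x k := by
  rw [xSeries, PowerSeries.coeff_mk, if_neg k.succ_ne_zero]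
  congr 1
  push_cast
  ring

/-- The lowering relations give the power relations of exponent one. -/
lemma sum_power_one_eq_zero {ρ : ULoop 𝔤 →ₐ[ℂ] Module.End ℂ M} {x : 𝔤} {w : M} {p : ℂ[X]}
    (hlow : ∀ f, invEval p ∣ f → ρ (loopGen x f) w = 0) (m : ℕ) (hm : p.natDegree < m) :
    ∑ k ∈ antidiagonal m, p.coeff k.2 • ρ (PowerSeries.coeff k.1 (xSeries x ^ 1)) w = 0 := by
  rw [pow_one, ← Finset.Nat.sum_antidiagonal_swap, Nat.sum_antidiagonal_eq_sum_range_succ_mk,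
    ← (lowering_iff ρ x w p).mpr hlow m]
  refine (sum_subset (range_mono (by omega)) fun k _ hk => ?_).symm.trans
    (sum_congr rfl fun k hk => ?_)
  · rw [mem_range] at hk
    rw [Prod.snd_swap, Polynomial.coeff_eq_zero_of_natDegree_lt (by simpa using hk), zero_smul]
  · rw [mem_range] at hk
    -- Since `k ≤ deg p < m`, the index `m - 1 - k` is nonnegative: the one-sided and the two-sided
    -- series agree on the terms used here.
    obtain ⟨j, rfl⟩ : ∃ j, m = k + j + 1 := ⟨m - k - 1, by omega⟩
    have h1 : k + j + 1 - k = j + 1 := by omega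
    have h2 : ((k + j + 1 : ℕ) : ℤ) - 1 - k = j := by push_cast; ring
    rw [Prod.snd_swap, Prod.fst_swap, h1, h2, coeff_succ_xSeries]

/-- The power relations can be tested in the commutative ring `B / Ann(w)`. -/
lemma sum_power_eq_zero_iff {ρ σ : ULoop 𝔤 →ₐ[ℂ] Module.End ℂ M} {x : 𝔤} {w : M}
    {e : LaurentPolynomial ℂ} (hσ : ∀ f, σ (loopGen x f) = ρ (loopGen x (e * f)))
    {B S : Type*} [CommRing B] [Algebra ℂ B] [CommRing S] [Algebra ℂ S]
    {φ : B →ₐ[ℂ] Module.End ℂ M} {g : LaurentPolynomial ℂ → B}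
    (hg : ∀ f, φ (g f) = ρ (loopGen x f)) {ψ : B →ₐ[ℂ] S} (hψ : ∀ b, ψ b = 0 ↔ φ b w = 0)
    (p : ℂ[X]) (r m : ℕ) :
    ∑ k ∈ antidiagonal m, p.coeff k.2 • σ (PowerSeries.coeff k.1 (xSeries x ^ r)) w = 0 ↔
      PowerSeries.coeff m ((PowerSeries.mk fun k : ℕ =>
        if k = 0 then 0 else ψ (g (e * LaurentPolynomial.T ((k : ℤ) - 1)))) ^ r *
          ((p.map (algebraMap ℂ S) : S[X]) : PowerSeries S)) = 0 := by
  set Y : PowerSeries B := PowerSeries.mk fun k : ℕ =>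
    if k = 0 then 0 else g (e * LaurentPolynomial.T ((k : ℤ) - 1)) with hY
  have hφ : PowerSeries.map (φ : B →+* Module.End ℂ M) Y =
      PowerSeries.map (σ : ULoop 𝔤 →+* Module.End ℂ M) (xSeries x) := by
    ext1 k
    rw [PowerSeries.coeff_map, PowerSeries.coeff_map, hY, xSeries, PowerSeries.coeff_mk,
      PowerSeries.coeff_mk]
    split_ifs
    · rw [map_zero, map_zero]
    · exact (hg _).trans (hσ _).symm
  have hψY : PowerSeries.map (ψ : B →+* S) Y = PowerSeries.mk fun k : ℕ =>
      if k = 0 then 0 else ψ (g (e * LaurentPolynomial.T ((k : ℤ) - 1))) := by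
    ext1 k
    rw [PowerSeries.coeff_map, hY, PowerSeries.coeff_mk, PowerSeries.coeff_mk]
    split_ifs
    · rw [map_zero]
    · rfl
  rw [sum_power_eq, ← hφ, ← hψY, ← polySeries_eq_coe, ← map_polySeries φ, ← map_polySeries ψ,
    ← map_pow, ← map_pow, ← map_mul, ← map_mul, PowerSeries.coeff_map, PowerSeries.coeff_map]
  exact (hψ _).symm

/-- If `e + e' = 1` with `e` divisible by the `π'_i(t⁻¹)` and `e'` by the `π_i(t⁻¹)`, a Weyl vector
for `π π'` is a Weyl vector for `π` with respect to the action twisted by `e`. -/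
lemma IsWeylVector.twist {ρ σ σ' : ULoop 𝔤 →ₐ[ℂ] Module.End ℂ M} {w : M} {π π' : I → ℂ[X]}
    (hπ : ∀ i, (π i).coeff 0 = 1) (hπ' : ∀ i, (π' i).coeff 0 = 1)
    (hcop : ∀ i, IsCoprime (π i) (π' i))
    (H : IsWeylVector h xp xm ρ w fun i => π i * π' i) {e e' : LaurentPolynomial ℂ}
    (he : e + e' = 1) (hσ : ∀ x f, σ (loopGen x f) = ρ (loopGen x (e * f)))
    (hσ' : ∀ x f, σ' (loopGen x f) = ρ (loopGen x (e' * f)))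
    (h1 : ∀ i, invEval (π' i) ∣ e) (h2 : ∀ i, invEval (π i) ∣ e') :
    IsWeylVector h xp xm σ w π := by
  have hlow : ∀ i f, invEval (π i) ∣ f → σ (loopGen (xm i) f) w = 0 := by
    intro i f hf
    rw [hσ]
    refine (lowering_iff ρ (xm i) w _).mp (H.lowering i) _ ?_
    rw [invEval_mul, mul_comm]
    exact mul_dvd_mul (h1 i) hf
  have hlow' : ∀ i f, invEval (π' i) ∣ f → σ' (loopGen (xm i) f) w = 0 := by
    intro i f hf
    rw [hσ']
    refine (lowering_iff ρ (xm i) w _).mp (H.lowering i) _ ?_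
    rw [invEval_mul]
    exact mul_dvd_mul (h2 i) hf
  have hne : ∀ {p : ℂ[X]}, p.coeff 0 = 1 → p ≠ 0 := by rintro p hp rfl; simp at hp
  refine ⟨fun i m => ?_, fun i m => ?_, fun i => ?_, fun i r m hm => ?_⟩
  · have : loopGenApply ρ (xp i) w = 0 := laurent_linear_ext fun m => H.raising i m
    rw [gen_eq_loopGen, hσ]
    exact LinearMap.congr_fun this _
  · have hc : (π i * π' i).coeff 0 = 1 := by rw [Polynomial.mul_coeff_zero, hπ, hπ', mul_one]
    have : loopGenApply ρ (h i) w = (sumEvalInv (π i * π' i)).smulRight w :=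
      laurent_linear_ext fun m => by
        rw [LinearMap.smulRight_apply, sumEvalInv_T hc]
        exact H.cartan i m
    rw [gen_eq_loopGen, hσ, ← loopGenApply_apply, this, LinearMap.smulRight_apply,
      sumEvalInv_mul (hπ i) (hπ' i) he (h1 i) (h2 i), sumEvalInv_T (hπ i)]
  · exact (lowering_iff σ (xm i) w _).mpr (hlow i)
  -- The operators `x_i⁻ ⊗ f` commute, so the power relations can be tested in a commutative algebra
  -- modulo the annihilator of `w`, where the partial fraction lemma applies.
  · obtain ⟨B, _, _, φ, g, hg⟩ := exists_commRing_lift (fun f => ρ (loopGen (xm i) f)) fun f f' => by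
      have := loopGen_lie (xm i) (xm i) f f'
      rw [lie_self, loopGen, TensorProduct.tmul_zero, map_zero] at this
      exact (Commute.map (sub_eq_zero.mp this.symm : _ = _) ρ)
    let J : Ideal B :=
      { carrier := {b | φ b w = 0}
        add_mem' := fun {a b} ha hb => by
          rw [Set.mem_ofPred_eq] at *
          rw [map_add, LinearMap.add_apply, ha, hb, add_zero]
        zero_mem' := by simp
        smul_mem' := fun c a ha => by
          rw [Set.mem_ofPred_eq] at *
          rw [smul_eq_mul, map_mul, Module.End.mul_apply, ha, map_zero] }
    have hψ : ∀ b, Ideal.Quotient.mkₐ ℂ J b = 0 ↔ φ b w = 0 := fun b =>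
      Ideal.Quotient.eq_zero_iff_mem
    generalize Ideal.Quotient.mkₐ ℂ J = ψ at hψ
    have hsum : (PowerSeries.mk fun k : ℕ =>
          if k = 0 then 0 else ψ (g (e * LaurentPolynomial.T ((k : ℤ) - 1)))) +
        (PowerSeries.mk fun k : ℕ =>
          if k = 0 then 0 else ψ (g (e' * LaurentPolynomial.T ((k : ℤ) - 1)))) =
        PowerSeries.mk fun k : ℕ =>
          if k = 0 then 0 else ψ (g (1 * LaurentPolynomial.T ((k : ℤ) - 1))) := by
      ext k
      rw [map_add, PowerSeries.coeff_mk, PowerSeries.coeff_mk, PowerSeries.coeff_mk]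
      split_ifs
      · rw [add_zero]
      -- The lifts `g f` are known only through φ, so additivity in `f` is checked on `w`.
      · rw [← map_add, ← sub_eq_zero, ← map_sub, hψ, map_sub, map_add, hg, hg, hg, ← map_add,
          ← loopGen_add, ← add_mul, he, sub_self, LinearMap.zero_apply]
    have hi := hσ (xm i)
    have hi' := hσ' (xm i)
    -- Here `Y` comes from `e`, `Z` from `e'`, and `Y + Z` is the series of the untwisted action.
    -- The lowering relations bound `Y` and `Z`; the power relations of ππ' bound the powers of the
    -- sum.
    refine (sum_power_eq_zero_iff hi hg hψ _ r m).mpr ((coeff_pow_mul_eq_zero (hcop i) (hne (hπ i))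
      (hne (hπ' i)) (Z := PowerSeries.mk fun k : ℕ =>
        if k = 0 then 0 else ψ (g (e' * LaurentPolynomial.T ((k : ℤ) - 1)))) (fun m hm => ?_) (fun m hm => ?_) (fun r m hm => ?_) r).1 m hm)
    · have := (sum_power_eq_zero_iff hi hg hψ _ 1 m).mp (sum_power_one_eq_zero (hlow i) m hm)
      rwa [pow_one] at this
    · have := (sum_power_eq_zero_iff hi' hg hψ _ 1 m).mp (sum_power_one_eq_zero (hlow' i) m hm)
      rwa [pow_one] at this
    · rw [hsum]
      refine (sum_power_eq_zero_iff (σ := ρ) (fun f => by rw [one_mul]) hg hψ _ r m).mp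
        (H.power i r m ?_)
      rwa [natDegree_mul_of_coeff_zero (hπ i) (hπ' i)]

end Twist

/-! ### The two mutually inverse maps -/

section Factorization

attribute [local instance] LieRing.ofAssociativeRing

variable {𝔤 : Type*} [LieRing 𝔤] [LieAlgebra ℂ 𝔤] {I : Type*}
variable {M : Type*} [AddCommGroup M] [Module ℂ M] {h xp xm : I → 𝔤}

/-- A `ℂ`-linear section of the quotient map `U → W(π)`. -/
lemma exists_weylMk_section (h xp xm : I → 𝔤) (π : I → ℂ[X]) :
    ∃ s : Weyl h xp xm π →ₗ[ℂ] ULoop 𝔤, ∀ z, weylMk h xp xm π (s z) = z := by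
  let q : ULoop 𝔤 →ₗ[ℂ] Weyl h xp xm π :=
    { toFun := weylMk h xp xm π
      map_add' := map_add _
      map_smul' := weylMk_smul h xp xm π }
  obtain ⟨s, hs⟩ := q.exists_rightInverse_of_surjective
    (LinearMap.range_eq_top.mpr (weylMk_surjective h xp xm π))
  exact ⟨s, LinearMap.congr_fun hs⟩

/-- The map out of `W(π)` given by a Weyl vector. -/
lemma IsWeylVector.exists_weylLift {ρ : ULoop 𝔤 →ₐ[ℂ] Module.End ℂ M} {w : M} {π : I → ℂ[X]}
    (H : IsWeylVector h xp xm ρ w π) (hπ : ∀ i, (π i).coeff 0 = 1) :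
    ∃ F : Weyl h xp xm π →ₗ[ℂ] M, ∀ a, F (weylMk h xp xm π a) = ρ a w := by
  obtain ⟨s, hs⟩ := exists_weylMk_section h xp xm π
  refine ⟨(ρ.toLinearMap.flip w) ∘ₗ s, fun a => ?_⟩
  have := H.apply_eq_zero hπ (a := s (weylMk h xp xm π a) - a) (by rw [map_sub, hs, sub_self])
  rw [map_sub, LinearMap.sub_apply, sub_eq_zero] at this
  exact this

/-- The map out of `W(π) ⊗ W(π')` given by a vector which is a Weyl vector for two commuting
actions. -/
lemma exists_weylTensorLift {σ σ' : ULoop 𝔤 →ₐ[ℂ] Module.End ℂ M}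
    (hcomm : ∀ a b, Commute (σ a) (σ' b)) {w : M} {π π' : I → ℂ[X]}
    (hπ : ∀ i, (π i).coeff 0 = 1) (hπ' : ∀ i, (π' i).coeff 0 = 1)
    (H : IsWeylVector h xp xm σ w π) (H' : IsWeylVector h xp xm σ' w π') :
    ∃ G : Weyl h xp xm π ⊗[ℂ] Weyl h xp xm π' →ₗ[ℂ] M,
      ∀ a b, G (weylMk h xp xm π a ⊗ₜ weylMk h xp xm π' b) = σ a (σ' b w) := by
  obtain ⟨s, hs⟩ := exists_weylMk_section h xp xm π
  obtain ⟨F, hF⟩ := H'.exists_weylLift hπ'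
  refine ⟨TensorProduct.lift ((LinearMap.lcomp ℂ M F ∘ₗ σ.toLinearMap) ∘ₗ s), fun a b => ?_⟩
  rw [TensorProduct.lift.tmul]
  change σ (s (weylMk h xp xm π a)) (F (weylMk h xp xm π' b)) = _
  rw [hF, ← sub_eq_zero, ← LinearMap.sub_apply, ← map_sub, ← Module.End.mul_apply,
    (hcomm _ _).eq, Module.End.mul_apply,
    H.apply_eq_zero hπ (by rw [map_sub, hs, sub_self]), map_zero]

/-- The action of `U` on the tensor product of two modules over `L(𝔤)`. -/
lemma exists_tensorRep (h xp xm : I → 𝔤) (π π' : I → ℂ[X]) :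
    ∃ σ : ULoop 𝔤 →ₐ[ℂ] Module.End ℂ (Weyl h xp xm π ⊗[ℂ] Weyl h xp xm π'),
      (∀ x f, σ (loopGen x f) =
        Module.End.rTensorAlgHom ℂ (Weyl h xp xm π) (Weyl h xp xm π')
          (weylRep h xp xm π (loopGen x f)) +
        Module.End.lTensorAlgHom ℂ (Weyl h xp xm π') (Weyl h xp xm π)
          (weylRep h xp xm π' (loopGen x f))) ∧
      ∀ (X : Loop 𝔤) z, σ (UniversalEnvelopingAlgebra.ι ℂ X) z = ⁅X, z⁆ := by
  let τ := LieModule.toEnd ℂ (Loop 𝔤) (Weyl h xp xm π ⊗[ℂ] Weyl h xp xm π')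
  have hτ : ∀ X, UniversalEnvelopingAlgebra.lift ℂ τ (UniversalEnvelopingAlgebra.ι ℂ X) = τ X :=
    UniversalEnvelopingAlgebra.lift_ι_apply ℂ τ
  refine ⟨UniversalEnvelopingAlgebra.lift ℂ τ, fun x f => ?_, fun X z => ?_⟩
  · rw [loopGen, hτ]
    exact TensorProduct.ext' fun u v => TensorProduct.LieModule.lie_tmul_right _ u v
  · rw [hτ]
    rfl

variable {π π' : I → ℂ[X]}

/-- The factorization of `W(π π')` for coprime `π`, `π'`, for a Lie algebra generated by the
`x_i^±`. -/
theorem nonempty_weyl_mul_equiv [Fintype I] [FiniteDimensional ℂ 𝔤]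
    (hgen : ∀ S : LieSubalgebra ℂ 𝔤, (∀ i, xp i ∈ S) → (∀ i, xm i ∈ S) → S = ⊤)
    (hπ : ∀ i, (π i).coeff 0 = 1) (hπ' : ∀ i, (π' i).coeff 0 = 1)
    (hcop : ∀ i j, IsCoprime (π i) (π' j)) :
    Nonempty (Weyl h xp xm (fun i => π i * π' i) ≃ₗ⁅ℂ, Loop 𝔤⁆
      Weyl h xp xm π ⊗[ℂ] Weyl h xp xm π') := by
  have hππ' : ∀ i, (π i * π' i).coeff 0 = 1 := fun i => by
    rw [Polynomial.mul_coeff_zero, hπ, hπ', mul_one]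
  have cyc : ∀ (p : I → ℂ[X]) (z : Weyl h xp xm p), ∃ a, weylRep h xp xm p a (weylMk h xp xm p 1) = z :=
    fun p z => by
      obtain ⟨a, rfl⟩ := weylMk_surjective h xp xm p z
      exact ⟨a, weylRep_mk_one h xp xm p a⟩
  have HV := isWeylVector_weylMk_one h xp xm (fun i => π i * π' i) hππ'
  have HW := isWeylVector_weylMk_one h xp xm π hπ
  have HW' := isWeylVector_weylMk_one h xp xm π' hπ'
  obtain ⟨N₀, hN₀⟩ := HV.exists_annihilator (cyc _) hgen
  obtain ⟨N₁, hN₁⟩ := HW.exists_annihilator (cyc _) hgen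
  obtain ⟨N₂, hN₂⟩ := HW'.exists_annihilator (cyc _) hgen
  set P := ∏ i, invEval (π i) with hP
  set Q := ∏ i, invEval (π' i) with hQ
  have hPQ : ∏ i, invEval (π i * π' i) = P * Q := by
    simp only [invEval_mul, Finset.prod_mul_distrib, hP, hQ]
  rw [hPQ] at hN₀
  -- One exponent serves all three modules; `N ≥ 1` is needed for `P` to divide `P ^ N`.
  obtain ⟨N, hN, h0, h1, h2⟩ : ∃ N, 1 ≤ N ∧ N₀ ≤ N ∧ N₁ ≤ N ∧ N₂ ≤ N :=
    ⟨N₀ + N₁ + N₂ + 1, by omega, by omega, by omega, by omega⟩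
  have hcopA : IsCoprime (P ^ N) (Q ^ N) :=
    (IsCoprime.prod_left fun i _ => IsCoprime.prod_right fun j _ =>
      (hcop i j).map (Polynomial.aeval (LaurentPolynomial.T (-1) :
        LaurentPolynomial ℂ)).toRingHom).pow
  obtain ⟨α, β, hαβ⟩ := hcopA
  -- By the Bézout identity, `e` is `1` modulo `P^N` and `0` modulo `Q^N`, and `e'` the reverse. The
  -- product `e e'` lies in the annihilating ideal of `V`, so both act as idempotents there.
  obtain ⟨e, he⟩ : ∃ e, e = β * Q ^ N := ⟨_, rfl⟩
  obtain ⟨e', he'⟩ : ∃ e', e' = α * P ^ N := ⟨_, rfl⟩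
  have hee' : e + e' = 1 := by rw [he, he', add_comm, hαβ]
  have hQe : Q ^ N ∣ e := ⟨β, by rw [he, mul_comm]⟩
  have hPe' : P ^ N ∣ e' := ⟨α, by rw [he', mul_comm]⟩
  have hPQee' : ∀ f, (P * Q) ^ N₀ ∣ e * e' * f := fun f => by
    refine ((pow_dvd_pow _ h0).trans ?_).mul_right f
    rw [mul_pow, mul_comm]
    exact mul_dvd_mul hQe hPe'
  set V := weylRep h xp xm (fun i => π i * π' i)
  set v := weylMk h xp xm (fun i => π i * π' i) 1
  have loopGen_eq : ∀ (f g : LaurentPolynomial ℂ) x, (∃ k, f = g + e * e' * k) →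
      V (loopGen x f) = V (loopGen x g) := by
    rintro _ g x ⟨k, rfl⟩
    refine LinearMap.ext fun z => ?_
    rw [loopGen_add, map_add, LinearMap.add_apply, hN₀ x _ z (hPQee' k), add_zero]
  have he2 : e' = 1 - e := by rw [← hee']; ring
  obtain ⟨σ, hσ⟩ := exists_twist V e fun x f =>
    loopGen_eq _ _ x ⟨-f, by rw [he2]; ring⟩
  obtain ⟨σ', hσ'⟩ := exists_twist V e' fun x f =>
    loopGen_eq _ _ x ⟨-f, by rw [he2]; ring⟩
  have hdiv : ∀ {p : I → ℂ[X]} i, invEval (p i) ∣ (∏ j, invEval (p j)) ^ N := fun i =>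
    (Finset.dvd_prod_of_mem (fun j => invEval _) (Finset.mem_univ i)).trans
      (dvd_pow_self _ (by omega))
  have Hσ : IsWeylVector h xp xm σ v π := HV.twist hπ hπ' (fun i => hcop i i) hee' hσ hσ'
    (fun i => (hdiv i).trans hQe) fun i => (hdiv i).trans hPe'
  have HV' : IsWeylVector h xp xm V v fun i => π' i * π i := by
    have : (fun i => π' i * π i) = fun i => π i * π' i := funext fun i => mul_comm _ _
    rw [this]; exact HV
  have Hσ' : IsWeylVector h xp xm σ' v π' := HV'.twist hπ' hπ (fun i => (hcop i i).symm)
    (by rw [add_comm, hee']) hσ' hσ (fun i => (hdiv i).trans hPe') fun i => (hdiv i).trans hQe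
  -- On generators the commutator is `⁅x, y⁆ ⊗ e e' f g`, which acts as zero.
  have hcomm : ∀ a b, Commute (σ a) (σ' b) := by
    intro a b
    induction a using loopGen_induction with
    | halg c => rw [AlgHom.commutes]; exact Algebra.commutes _ _
    | hadd a a' ha ha' => rw [map_add]; exact ha.add_left ha'
    | hmul a a' ha ha' => rw [map_mul]; exact ha.mul_left ha'
    | hgen x f =>
      induction b using loopGen_induction with
      | halg c => rw [AlgHom.commutes]; exact (Algebra.commutes _ _).symm
      | hadd a a' ha ha' => rw [map_add]; exact ha.add_right ha'
      | hmul a a' ha ha' => rw [map_mul]; exact ha.mul_right ha'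
      | hgen y g =>
        have h3 : V (loopGen ⁅x, y⁆ (e * f * (e' * g))) = 0 := LinearMap.ext fun z => by
          rw [show e * f * (e' * g) = e * e' * (f * g) by ring]
          exact hN₀ _ _ z (hPQee' _)
        rw [loopGen_lie, map_sub, map_mul, map_mul, sub_eq_zero] at h3
        rw [hσ, hσ']
        exact h3
  obtain ⟨τ, hτ, hτι⟩ := exists_tensorRep h xp xm π π'
  obtain ⟨F, hF⟩ := (HW.tmul hτ hπ hπ' HW').exists_weylLift hππ'
  obtain ⟨G, hG⟩ := exists_weylTensorLift hcomm hπ hπ' Hσ Hσ'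
  set w := weylMk h xp xm π 1
  set w' := weylMk h xp xm π' 1
  have hFV : ∀ a z, F (V a z) = τ a (F z) := by
    intro a z
    obtain ⟨b, rfl⟩ := weylMk_surjective h xp xm _ z
    have : V a (weylMk h xp xm (fun i => π i * π' i) b) =
        weylMk h xp xm (fun i => π i * π' i) (a * b) :=
      ((weylMk h xp xm (fun i => π i * π' i)).map_smul a b).symm
    rw [this, hF, hF, map_mul, Module.End.mul_apply]
  -- Multiplication by `e` changes nothing on `W(π)`, which is killed by `(P^N)`, and gives zero on
  -- `W(π')`, which is killed by `(Q^N)`. So σ corresponds to the action on the left factor alone.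
  have hFσ : ∀ a z, F (σ a z) = Module.End.rTensorAlgHom ℂ _ _ (weylRep h xp xm π a) (F z) := by
    intro a
    induction a using loopGen_induction with
    | halg c =>
      intro z
      rw [AlgHom.commutes, AlgHom.commutes, AlgHom.commutes, Module.algebraMap_end_apply,
        Module.algebraMap_end_apply, map_smul]
    | hadd a b ha hb =>
      intro z
      rw [map_add, map_add, map_add, LinearMap.add_apply, LinearMap.add_apply, map_add, ha, hb]
    | hmul a b ha hb =>
      intro z
      rw [map_mul, map_mul, map_mul, Module.End.mul_apply, Module.End.mul_apply, ha, hb]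
    | hgen x f =>
      intro z
      have e1 : weylRep h xp xm π (loopGen x (e * f)) = weylRep h xp xm π (loopGen x f) := by
        have : e * f = f + P ^ N * (-(α * f)) := by
          rw [eq_sub_of_add_eq hee', he']; ring
        refine LinearMap.ext fun u => ?_
        rw [this, loopGen_add, map_add, LinearMap.add_apply,
          hN₁ x _ u ((pow_dvd_pow P h1).mul_right _), add_zero]
      have e2 : weylRep h xp xm π' (loopGen x (e * f)) = 0 := LinearMap.ext fun u =>
        hN₂ x _ u (((pow_dvd_pow Q h2).trans hQe).mul_right _)
      rw [hσ, hFV, hτ, e1, e2, map_zero, add_zero]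
  have hFσ' : ∀ a z, F (σ' a z) = Module.End.lTensorAlgHom ℂ _ _ (weylRep h xp xm π' a) (F z) := by
    intro a
    induction a using loopGen_induction with
    | halg c =>
      intro z
      rw [AlgHom.commutes, AlgHom.commutes, AlgHom.commutes, Module.algebraMap_end_apply,
        Module.algebraMap_end_apply, map_smul]
    | hadd a b ha hb =>
      intro z
      rw [map_add, map_add, map_add, LinearMap.add_apply, LinearMap.add_apply, map_add, ha, hb]
    | hmul a b ha hb =>
      intro z
      rw [map_mul, map_mul, map_mul, Module.End.mul_apply, Module.End.mul_apply, ha, hb]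
    | hgen x f =>
      intro z
      have e1 : weylRep h xp xm π' (loopGen x (e' * f)) = weylRep h xp xm π' (loopGen x f) := by
        have : e' * f = f + Q ^ N * (-(β * f)) := by
          rw [he2, he]; ring
        refine LinearMap.ext fun u => ?_
        rw [this, loopGen_add, map_add, LinearMap.add_apply,
          hN₂ x _ u ((pow_dvd_pow Q h2).mul_right _), add_zero]
      have e2 : weylRep h xp xm π (loopGen x (e' * f)) = 0 := LinearMap.ext fun u =>
        hN₁ x _ u (((pow_dvd_pow P h1).trans hPe').mul_right _)
      rw [hσ', hFV, hτ, e1, e2, map_zero, zero_add]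
  have hFv : F v = w ⊗ₜ w' := by rw [hF, map_one, Module.End.one_apply]
  have hFG : F ∘ₗ G = LinearMap.id := by
    refine TensorProduct.ext' fun a b => ?_
    obtain ⟨a, rfl⟩ := weylMk_surjective h xp xm π a
    obtain ⟨b, rfl⟩ := weylMk_surjective h xp xm π' b
    rw [LinearMap.comp_apply, hG, hFσ, hFσ', hFv, LinearMap.id_apply]
    change weylRep h xp xm π a w ⊗ₜ weylRep h xp xm π' b w' = _
    rw [weylRep_mk_one, weylRep_mk_one]
  have hVσ : ∀ x f, V (loopGen x f) = σ (loopGen x f) + σ' (loopGen x f) := by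
    intro x f
    rw [hσ, hσ', ← map_add, ← loopGen_add, ← add_mul, hee', one_mul]
  -- The splitting of `V` on generators into σ plus σ' mirrors the coproduct, and `G` takes the two
  -- factors to σ and σ'.
  have hGτ : ∀ a z, G (τ a z) = V a (G z) := by
    intro a
    induction a using loopGen_induction with
    | halg c =>
      intro z
      rw [AlgHom.commutes, AlgHom.commutes, Module.algebraMap_end_apply,
        Module.algebraMap_end_apply, map_smul]
    | hadd a b ha hb =>
      intro z
      rw [map_add, map_add, LinearMap.add_apply, LinearMap.add_apply, map_add, ha, hb]
    | hmul a b ha hb =>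
      intro z
      rw [map_mul, map_mul, Module.End.mul_apply, Module.End.mul_apply, ha, hb]
    | hgen x f =>
      intro z
      induction z using TensorProduct.induction_on with
      | zero => rw [map_zero, map_zero, map_zero]
      | add y z hy hz => rw [map_add, map_add, map_add, map_add, hy, hz]
      | tmul y z =>
        obtain ⟨a, rfl⟩ := weylMk_surjective h xp xm π y
        obtain ⟨b, rfl⟩ := weylMk_surjective h xp xm π' z
        have h3 : τ (loopGen x f) (weylMk h xp xm π a ⊗ₜ weylMk h xp xm π' b) =
            weylMk h xp xm π (loopGen x f * a) ⊗ₜ weylMk h xp xm π' b +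
              weylMk h xp xm π a ⊗ₜ weylMk h xp xm π' (loopGen x f * b) := by
          rw [hτ, ← smul_eq_mul, ← smul_eq_mul, map_smul, map_smul]
          rfl
        rw [h3, map_add, hG, hG, hG, hVσ, LinearMap.add_apply, map_mul, map_mul,
          Module.End.mul_apply, Module.End.mul_apply]
        congr 1
        rw [← Module.End.mul_apply, (hcomm _ _).eq, Module.End.mul_apply]
  -- Both maps commute with `U` and the composite fixes the cyclic vector `v`.
  have hGF : G ∘ₗ F = LinearMap.id := by
    refine LinearMap.ext fun z => ?_
    obtain ⟨a, rfl⟩ := cyc _ z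
    have hGv : G (w ⊗ₜ w') = v := by
      rw [hG, map_one, map_one, Module.End.one_apply, Module.End.one_apply]
    rw [LinearMap.comp_apply, hFV, hGτ, hFv, hGv, LinearMap.id_apply]
  exact ⟨{ F with
    map_lie' := fun {X z} => (hFV (UniversalEnvelopingAlgebra.ι ℂ X) z).trans (hτι X _)
    invFun := G
    left_inv := LinearMap.congr_fun hGF
    right_inv := LinearMap.congr_fun hFG }⟩

end Factorization

end LoopWeyl

end

theorem theorem2 {𝔤 : Type*} [LieRing 𝔤] [LieAlgebra ℂ 𝔤] [FiniteDimensional ℂ 𝔤]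
    [LieAlgebra.IsSimple ℂ 𝔤]
    (H : LieSubalgebra ℂ 𝔤) [H.IsCartanSubalgebra]
    (b : (LieAlgebra.IsKilling.rootSystem H).Base)
    (xp xm : b.support → 𝔤)
    (hxp : ∀ i : b.support, xp i ∈ LieAlgebra.rootSpace H (i.1.1 : H → ℂ))
    (hxm : ∀ i : b.support, xm i ∈ LieAlgebra.rootSpace H (-(i.1.1 : H → ℂ)))
    (hsl2 : ∀ i : b.support,
      IsSl2Triple (LieAlgebra.IsKilling.coroot i.1.1 : 𝔤) (xp i) (xm i))
    (π π' : b.support → ℂ[X])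
    (hπ : ∀ i, (π i).coeff 0 = 1) (hπ' : ∀ i, (π' i).coeff 0 = 1)
    (hcop : ∀ i j, IsCoprime (π i) (π' j)) :
    Nonempty
      (LoopWeyl.Weyl (fun i : b.support => (LieAlgebra.IsKilling.coroot i.1.1 : 𝔤)) xp xm
          (fun i => π i * π' i)
        ≃ₗ⁅ℂ, LoopWeyl.Loop 𝔤⁆
      LoopWeyl.Weyl (fun i : b.support => (LieAlgebra.IsKilling.coroot i.1.1 : 𝔤)) xp xm π
        ⊗[ℂ]
      LoopWeyl.Weyl (fun i : b.support => (LieAlgebra.IsKilling.coroot i.1.1 : 𝔤)) xp xm π') :=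
  -- The structure of `𝔤` enters only through finite-dimensionality and generation by the `x_i^±`,
  -- which are nonzero as members of `sl₂`-triples.
  LoopWeyl.nonempty_weyl_mul_equiv
    (fun _ hp hm => LoopWeyl.eq_top_of_simple_root_vectors_mem b xp xm hxp hxm
      (fun i => (hsl2 i).e_ne_zero) (fun i => (hsl2 i).f_ne_zero) hp hm)
    hπ hπ' hcop
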